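/- Consider an open network of $J$ infinite server queues. Batches arrive at the points $T_1\le T_2\le\cdots$ of a non-homogeneous Poisson process on $[0,\infty)$ with rate $\lambda(\tau)\ge 0$, integrable on bounded intervals. The $i$-th batch brings $\Sigma_{ij}$ customers to queue $j$; the vectors $\boldsymbol\Sigma_i=(\Sigma_{i1},\dots,\Sigma_{iJ})$ are i.i.d. The $\ell$-th customer of batch $i$ who enters at queue $j$ carries a measurable process $X^j_{i,\ell}(s)$, $s\ge 0$, where $X^j_{i,\ell}(s)=k\in\{1,\dots,J\}$ means that the customer is in queue $k$ at time $T_i+s$ (otherwise the customer has left the network), and $P(X^j_{i,\ell}(s)=k)=q^j_k(s)$. The arrival times, the batch vectors and the processes $X^j_{i,\ell}$ are mutually independent. Let $\mathbf N(t)=(N_1(t),\dots,N_J(t))$ be the numbers of customers in the queues at time $t\ge 0$, the network being empty before time $0$. Suppose that the batches are univariate with size $S\sim\mathrm{Binomial}(N,\alpha)$, $N\in\{0,1,2,\dots\}$, $\alpha\in[0,1]$, each customer being independently assigned entry queue $j$ with probability $p_j$ ($p_j\ge 0$, $\sum_{j=1}^J p_j=1$); that is, $$E\Big[\prod_{j=1}^J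 z_j^{\Sigma_{ij}}\Big]=G_S\Big(\sum_{j=1}^J p_jz_j\Big)\quad\text{for all complex } z_j \text{ with } |z_j|\le 1,\qquad G_S(w)=E[w^S].$$ Put $q_k(s)=\sum_{j=1}^J p_j\,q^j_k(s)$. Then for every $t\ge 0$, every $v\in\{2,\dots,J\}$ and all non-negative integers $n_1,\dots,n_v$ with $n_v\ge 1$, \begin{align*} P\big[\mathbf N(t)=(n_1,\dots,n_v,0,\dots,0)\big] =\sum_{i_1=0}^{n_1}\cdots\sum_{i_{v-1}=0}^{n_{v-1}}\sum_{i_v=1}^{n_v}\Bigg[&\frac{i_v}{n_v}\,P\big[\mathbf N(t)=(n_1-i_1,\dots,n_v-i_v,0,\dots,0)\big]\,\mathbf 1_{\{\sum_{k=1}^v i_k\le N\}}\\ &\cdot\int_0^t\lambda(\tau)\,\frac{N!}{\big(N-\sum_{k=1}^v i_k\big)!}\Big(1-\alpha\sum_{k=1}^{J}q_k(t-\tau)\Big)^{N-\sum_{k=1}^v i_k}\prod_{k=1}^v\frac{(\alpha q_k(t-\tau))^{i_k}}{i_k!}\,d\tau\Bigg], \end{align*} where the integrands are integrable on $[0,t]$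 (a term whose indicator is $0$ is read as $0$, and $0^0=1$). -/

import Mathlib

open MeasureTheory ProbabilityTheory
open scoped ENNReal NNReal

noncomputable section

namespace BatchQueue

variable {Ω : Type*} [MeasurableSpace Ω]

/-- The number of arrival times lying in `A`. An arrival time equal to `∞` means that the
corresponding arrival never occurs (there may be only finitely many arrivals in all). -/
def arrivalCount (T : ℕ → Ω → ℝ≥0∞) (A : Set ℝ) (ω : Ω) : ℕ∞ :=
  Set.encard {i : ℕ | T i ω ≠ ∞ ∧ (T i ω).toReal ∈ A}

/-- `T 0 ≤ T 1 ≤ ...` are the points of a non-homogeneous Poisson process on `[0, ∞)` with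
rate `lam`: the number of points in a bounded Borel set `A ⊆ [0, ∞)` has the Poisson law with
parameter `∫ τ in A, lam τ`, and the numbers of points in disjoint such sets are independent. -/
structure IsPoissonArrivals (P : Measure Ω) (lam : ℝ → ℝ) (T : ℕ → Ω → ℝ≥0∞) : Prop where
  rate_nonneg : ∀ τ, 0 ≤ τ → 0 ≤ lam τ
  rate_integrable : ∀ t, 0 ≤ t → IntervalIntegrable lam volume 0 t
  measurable : ∀ i, Measurable (T i)
  ordered : ∀ᵐ ω ∂P, Monotone fun i => T i ω
  poisson : ∀ A : Set ℝ, MeasurableSet A → A ⊆ Set.Ici 0 → Bornology.IsBounded A →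
    HasLaw (arrivalCount T A)
      ((poissonMeasure (∫ τ in A, lam τ).toNNReal).map (fun m : ℕ => (m : ℕ∞))) P
  indep : ∀ A : ℕ → Set ℝ, (∀ m, MeasurableSet (A m)) → (∀ m, A m ⊆ Set.Ici 0) →
    (∀ m, Bornology.IsBounded (A m)) → Pairwise (fun m m' => Disjoint (A m) (A m')) →
    iIndepFun (fun m => arrivalCount T (A m)) P

/-- The sources of randomness: the arrival times, the size vector of each batch, and the route
of each customer (batch `i`, entry queue `j`, label `l` among the customers of batch `i` that
enter at queue `j`). -/
inductive Source (J : ℕ) : Type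
  | arrivals : Source J
  | batch (i : ℕ) : Source J
  | route (i : ℕ) (j : Fin J) (l : ℕ) : Source J

/-- The information carried by each source of randomness; `𝒢 i j l` is the information carried
by the route of customer `(i, j, l)`. -/
@[reducible] def sourceSigma {J : ℕ} (T : ℕ → Ω → ℝ≥0∞) (S : ℕ → Ω → Fin J → ℕ)
    (𝒢 : ℕ → Fin J → ℕ → MeasurableSpace Ω) : Source J → MeasurableSpace Ω
  | .arrivals => MeasurableSpace.comap (fun ω i => T i ω) inferInstance
  | .batch i => MeasurableSpace.comap (S i) inferInstance
  | .route i j l => 𝒢 i j l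

/-- An open network of `J` infinite server queues with batch Poisson arrivals.
* `T i` is the time of the `i`-th arrival event.
* `S i ω j` is the number of customers of batch `i` arriving at queue `j`.
* `X i j l s ω = some k` means that the `l`-th customer of batch `i` entering at queue `j` is in
  queue `k` when a time `s ≥ 0` has passed since its arrival, and `X i j l s ω = none` means that
  it has then left the network.
* `q j k s` is the probability that a customer who entered at queue `j` is in queue `k` a time
  `s` after its arrival.

The arrival times, the batches and the routes are all mutually independent. The route of each
customer is a (jointly) measurable process `(s, ω) ↦ X i j l s ω` with respect to the information
`𝒢 i j l` carried by that route. -/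
structure IsNetwork (P : Measure Ω) {J : ℕ} (lam : ℝ → ℝ) (q : Fin J → Fin J → ℝ → ℝ)
    (T : ℕ → Ω → ℝ≥0∞) (S : ℕ → Ω → Fin J → ℕ)
    (X : ℕ → Fin J → ℕ → ℝ → Ω → Option (Fin J)) : Prop where
  arrivals : IsPoissonArrivals P lam T
  batch_measurable : ∀ i, Measurable (S i)
  batch_identDistrib : ∀ i, IdentDistrib (S i) (S 0) P P
  route_law : ∀ i j l k s, 0 ≤ s → P.real {ω | X i j l s ω = some k} = q j k s
  independent : ∃ 𝒢 : ℕ → Fin J → ℕ → MeasurableSpace Ω,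
    (∀ i j l, 𝒢 i j l ≤ ‹MeasurableSpace Ω›) ∧
    (∀ i j l k, MeasurableSet[(borel ℝ).prod (𝒢 i j l)]
      {x : ℝ × Ω | 0 ≤ x.1 ∧ X i j l x.1 x.2 = some k}) ∧
    iIndep (sourceSigma T S 𝒢) P

/-- The number of customers of batch `i` that are in queue `k` a time `s` after its arrival. -/
def batchOccupancy {J : ℕ} (S : ℕ → Ω → Fin J → ℕ)
    (X : ℕ → Fin J → ℕ → ℝ → Ω → Option (Fin J)) (i : ℕ) (s : ℝ) (ω : Ω) (k : Fin J) : ℕ :=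
  ∑ j : Fin J, ∑ l ∈ Finset.range (S i ω j), if X i j l s ω = some k then 1 else 0

/-- The number of customers in queue `k` at time `t`. Almost surely only finitely many batches
arrive up to time `t`, so the sum is finite. -/
def occupancy {J : ℕ} (T : ℕ → Ω → ℝ≥0∞) (S : ℕ → Ω → Fin J → ℕ)
    (X : ℕ → Fin J → ℕ → ℝ → Ω → Option (Fin J)) (t : ℝ) (ω : Ω) (k : Fin J) : ℕ :=
  ∑ᶠ i : ℕ,
    if T i ω ≤ ENNReal.ofReal t then batchOccupancy S X i (t - (T i ω).toReal) ω k else 0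

/-- The probability generating function of a law on `ℕ`. -/
def pgf (μ : Measure ℕ) (w : ℂ) : ℂ := ∫ m : ℕ, w ^ m ∂μ

/-- The multivariate probability generating function of a random vector. -/
def vectorPgf {J : ℕ} (P : Measure Ω) (S : Ω → Fin J → ℕ) (z : Fin J → ℂ) : ℂ :=
  ∫ ω, ∏ j, z j ^ S ω j ∂P

/-- The random vector `S` is a univariate batch whose size has law `μ`, each customer being
assigned an entry queue independently, queue `j` with probability `p j`:
`E[∏ j, z j ^ S j] = G (∑ j, p j * z j)` on the closed unit polydisc, `G` being the probability
generating function of `μ`. -/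
def IsUnivariateBatch {J : ℕ} (P : Measure Ω) (μ : Measure ℕ) (p : Fin J → ℝ)
    (S : Ω → Fin J → ℕ) : Prop :=
  ∀ z : Fin J → ℂ, (∀ j, ‖z j‖ ≤ 1) → vectorPgf P S z = pgf μ (∑ j, (p j : ℂ) * z j)

/-- The probability that a customer is in queue `k` a time `s` after its arrival into the
network, when the entry queue is `j` with probability `p j`. -/
def mixedLocation {J : ℕ} (p : Fin J → ℝ) (q : Fin J → Fin J → ℝ → ℝ) (k : Fin J) (s : ℝ) : ℝ :=
  ∑ j, p j * q j k s

/-- `N! / (N - Σ_{k ≤ v} i_k)! * (1 - α Σ_k r_k)^(N - Σ_{k ≤ v} i_k) * ∏_{k ≤ v} (α r_k)^i_k / i_k!`,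
where `Σ_k r_k` is over all queues. Meant for `Σ_{k ≤ v} i_k ≤ N`. -/
def binomialKernel {J : ℕ} (N : ℕ) (α : ℝ) (r : Fin J → ℝ) (v : Fin J) (i : Fin J → ℕ) : ℝ :=
  (N.factorial : ℝ) / ((N - ∑ k ∈ Finset.Iic v, i k).factorial : ℝ)
    * (1 - α * ∑ k, r k) ^ (N - ∑ k ∈ Finset.Iic v, i k)
    * ∏ k ∈ Finset.Iic v, (α * r k) ^ i k / ((i k).factorial : ℝ)

/-- The index set `0 ≤ i_k ≤ n_k` for `k ≠ v` and `1 ≤ i_v ≤ n_v`. -/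
def recurrenceIndices {J : ℕ} (n : Fin J → ℕ) (v : Fin J) : Finset (Fin J → ℕ) :=
  Fintype.piFinset fun k => Finset.Icc (if k = v then 1 else 0) (n k)

end BatchQueue

end

/-! The vector of occupancies at time `t` is compound Poisson, and the recurrence is the Panjer
recursion for that law.

Write `r_k` for the mixed location probability at age `t - τ`. By the binomial form of the batch
generating function, a batch arriving at `τ` has at time `t` the generating function `(1 - α ∑ r_k +
∑ α r_k z_k) ^ N`. Its coefficients `K_i(τ)`, given by the multinomial theorem, are the kernels of
the statement (`sum_kernelOn_mul_prod_pow`); they sum to `1` and vanish unless `∑ i_k ≤ N`. Freezing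
arrivals and batch sizes and averaging over routes, then over batches, reduces the occupancy to a
product over arrival times. The Poisson generating functional
(`IsPoissonArrivals.integral_arrivalProd`) then gives `E ∏ z_k ^ N_k(t) = exp ∑_i c_i (z^i - 1)`
with `c_i = ∫ λ K_i`. Generating functions on the torus determine the law, so `N(t)` is distributed
as `∑_i Y_i • i` with `Y_i` independent Poisson of parameter `c_i` (`IsNetwork.map_occupancy`).

On the event `∑ Y_i • i = n` one has `n_v = ∑ i_v Y_i`. The Mecke identity `E[Y_i f(Y)] = c_i E[f(Y
+ e_i)]` turns this into `n_v P(n) = ∑ i_v c_i P(n - i)` (`compoundPoisson_recurrence`). Dividing by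
`n_v` gives the theorem: only `i ≤ n` with `i_v ≥ 1` contribute, and such `i` vanish beyond queue
`v`. -/

namespace BatchQueue

/-! ### Generating functions and compound Poisson laws -/

/-- A finite measure on `ι → ℕ` is determined by its probability generating function on the
unit torus. -/
theorem ext_of_pgf {ι : Type*} [Fintype ι] {μ ν : Measure (ι → ℕ)} [IsFiniteMeasure μ]
    [IsFiniteMeasure ν]
    (h : ∀ z : ι → ℂ, (∀ k, ‖z k‖ = 1) → ∫ n, ∏ k, z k ^ n k ∂μ = ∫ n, ∏ k, z k ^ n k ∂ν) :
    μ = ν := by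
  let f : (ι → ℕ) → EuclideanSpace ℝ ι := fun n => WithLp.toLp 2 fun k => (n k : ℝ)
  have hf : Measurable f := .of_discrete
  have hinj : Function.Injective f := by
    intro a b hab
    funext k
    have := congrArg (fun x : EuclideanSpace ℝ ι => x k) hab
    simpa [f] using this
  -- Under the embedding of `ℕ^ι` in Euclidean space, the characteristic function at `t` is the
  -- generating function at `z_k = exp(i t_k)`, so values on the torus suffice.
  have key : ∀ (ρ : Measure (ι → ℕ)) (t : EuclideanSpace ℝ ι), charFun (ρ.map f) t =
      ∫ n, ∏ k, Complex.exp (t k * Complex.I) ^ n k ∂ρ := by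
    intro ρ t
    rw [charFun_apply, integral_map hf.aemeasurable (by fun_prop)]
    congr 1
    funext n
    simp only [f, PiLp.inner_apply, ← Complex.exp_nat_mul, ← Complex.exp_sum]
    congr 1
    simp [mul_comm, Finset.mul_sum, mul_left_comm]
  have hmap : μ.map f = ν.map f := by
    have : IsFiniteMeasure (μ.map f) := inferInstance
    apply Measure.ext_of_charFun
    funext t
    rw [key, key]
    exact h _ fun k => Complex.norm_exp_ofReal_mul_I _
  ext s hs
  have hs' : MeasurableSet (f '' s) := (s.to_countable.image f).measurableSet
  have := congrArg (fun ρ => ρ (f '' s)) hmap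
  simpa [Measure.map_apply hf hs', Set.preimage_image_eq s hinj] using this

theorem integral_pow_poissonMeasure (r : ℝ≥0) (z : ℂ) :
    ∫ m : ℕ, z ^ m ∂(poissonMeasure r) = Complex.exp (r * (z - 1)) := by
  rw [integral_poissonMeasure]
  have h := (NormedSpace.expSeries_div_hasSum_exp (r * z : ℂ)).mul_left (Complex.exp (-r))
  rw [← Complex.exp_eq_exp_ℂ, ← Complex.exp_add] at h
  rw [show (r : ℂ) * (z - 1) = -r + r * z by ring, ← h.tsum_eq]
  congr 1
  funext m
  rw [Complex.real_smul]
  push_cast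
  rw [mul_pow]
  ring

/-- The Mecke identity at one point: `(m + 1) r^(m+1) / (m+1)! = r · r^m / m!`. -/
theorem add_one_mul_poissonMeasure_singleton (r : ℝ≥0) (m : ℕ) :
    ((m + 1 : ℕ) : ℝ≥0∞) * poissonMeasure r {m + 1} = r * poissonMeasure r {m} := by
  rw [poissonMeasure_singleton, poissonMeasure_singleton, ← ENNReal.ofReal_natCast,
    ← ENNReal.ofReal_coe_nnreal, ← ENNReal.ofReal_mul (by positivity),
    ← ENNReal.ofReal_mul (by positivity)]
  congr 1
  rw [Nat.factorial_succ]
  push_cast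
  field_simp
  rw [pow_succ']

/-- The one-dimensional Mecke identity in one coordinate of a vector of independent Poisson
variables. -/
theorem lintegral_coord_mul_pi_poissonMeasure {I : Type*} [Fintype I] [DecidableEq I] (c : I → ℝ≥0)
    (i : I) (f : (I → ℕ) → ℝ≥0∞) :
    ∫⁻ y, (y i : ℝ≥0∞) * f y ∂(Measure.pi fun i => poissonMeasure (c i)) =
      c i * ∫⁻ y, f (y + Pi.single i 1) ∂(Measure.pi fun i => poissonMeasure (c i)) := by
  rw [lintegral_countable', lintegral_countable', ← ENNReal.tsum_mul_left]
  have hinj : Function.Injective fun y : I → ℕ => y + Pi.single i 1 := add_left_injective _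
  -- Reindex by `y ↦ y + e_i`: a point outside the range has `y i = 0`, and the factor `y i` kills
  -- its term.
  rw [← hinj.tsum_eq]
  · congr 1
    funext y
    rw [Measure.pi_singleton, Measure.pi_singleton,
      ← Finset.mul_prod_erase _ _ (Finset.mem_univ i), ← Finset.mul_prod_erase _ _ (Finset.mem_univ i)]
    have h1 : ∏ x ∈ Finset.univ.erase i, poissonMeasure (c x) {(y + Pi.single i 1 : I → ℕ) x} =
        ∏ x ∈ Finset.univ.erase i, poissonMeasure (c x) {y x} := by
      refine Finset.prod_congr rfl fun x hx => ?_
      simp [Pi.single_eq_of_ne (Finset.ne_of_mem_erase hx)]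
    have h2 := add_one_mul_poissonMeasure_singleton (c i) (y i)
    rw [h1]
    simp only [Pi.add_apply, Pi.single_eq_same]
    calc _ = (((y i + 1 : ℕ) : ℝ≥0∞) * poissonMeasure (c i) {y i + 1}) * f (y + Pi.single i 1) *
          ∏ x ∈ Finset.univ.erase i, poissonMeasure (c x) {y x} := by ring
      _ = _ := by rw [h2]; ring
  · intro y hy
    have hyi : y i ≠ 0 := by
      intro h0
      simp [h0] at hy
    refine ⟨y - Pi.single i 1, ?_⟩
    funext k
    by_cases hk : k = i
    · subst hk
      simp
      omega
    · simp [Pi.single_eq_of_ne hk]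

/-- The law of `∑ i, Y i • e i`, where the `Y i` are independent and `Y i` is Poisson with
parameter `c i`. -/
noncomputable def compoundPoisson {ι I : Type*} [Fintype I] (c : I → ℝ≥0) (e : I → ι → ℕ) :
    Measure (ι → ℕ) :=
  (Measure.pi fun i => poissonMeasure (c i)).map fun y => ∑ i, y i • e i

instance {ι I : Type*} [Fintype I] [Finite ι] (c : I → ℝ≥0) (e : I → ι → ℕ) :
    IsProbabilityMeasure (compoundPoisson c e) := by
  unfold compoundPoisson
  exact Measure.isProbabilityMeasure_map (Measurable.of_discrete).aemeasurable

/-- The monomial at `∑ y_i • e_i` is `∏_i (z^{e_i})^{y_i}`, so independence reduces the integral to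
Poisson generating functions at the points `z^{e_i}`. -/
theorem integral_compoundPoisson {ι I : Type*} [Fintype I] [Fintype ι] (c : I → ℝ≥0)
    (e : I → ι → ℕ) (z : ι → ℂ) :
    ∫ n, ∏ k, z k ^ n k ∂(compoundPoisson c e) =
      Complex.exp (∑ i, c i * (∏ k, z k ^ e i k - 1)) := by
  rw [compoundPoisson, integral_map (Measurable.of_discrete).aemeasurable
    (by exact (Measurable.of_discrete).aestronglyMeasurable), Complex.exp_sum]
  simp_rw [← integral_pow_poissonMeasure]
  rw [← integral_fintype_prod_eq_prod]
  congr 1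
  funext y
  simp_rw [← Finset.prod_pow]
  rw [Finset.prod_comm]
  refine Finset.prod_congr rfl fun k _ => ?_
  simp_rw [← pow_mul]
  rw [Finset.prod_pow_eq_pow_sum]
  congr 1
  simp [Finset.sum_apply, mul_comm]

/-- The multivariate Panjer recursion. -/
theorem compoundPoisson_recurrence {ι I : Type*} [Fintype I] [Finite ι] (c : I → ℝ≥0)
    (e : I → ι → ℕ) (n : ι → ℕ) (v : ι) :
    (n v : ℝ≥0∞) * compoundPoisson c e {n} =
      ∑ i, (e i v : ℝ≥0∞) * (c i * compoundPoisson c e {m | m + e i = n}) := by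
  classical
  have hm : Measurable fun y : I → ℕ => ∑ i, y i • e i := .of_discrete
  simp only [compoundPoisson, Measure.map_apply hm .of_discrete]
  set π := Measure.pi fun i => poissonMeasure (c i)
  set A : Set (I → ℕ) := (fun y : I → ℕ => ∑ i, y i • e i) ⁻¹' {n} with hA
  -- On `A` the coordinate `n v` equals `∑ y_i e_i(v)`. The Mecke identity is then applied to each
  -- summand, and shifting `y_i` by one adds `e i` to the total.
  have h1 : (n v : ℝ≥0∞) * π A =
      ∫⁻ y, ∑ i, (e i v : ℝ≥0∞) * ((y i : ℝ≥0∞) * A.indicator 1 y) ∂π := by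
    rw [← lintegral_indicator_one (μ := π) (s := A) .of_discrete,
      ← lintegral_const_mul _ .of_discrete]
    congr 1
    funext y
    by_cases hy : y ∈ A
    · have : ∑ i, y i • e i = n := hy
      simp only [Set.indicator_of_mem hy, ← this]
      simp [Finset.sum_apply, mul_comm]
    · simp [hy]
  rw [h1, lintegral_finsetSum _ fun _ _ => .of_discrete]
  refine Finset.sum_congr rfl fun i _ => ?_
  rw [lintegral_const_mul _ .of_discrete, lintegral_coord_mul_pi_poissonMeasure]
  congr 2
  rw [← lintegral_indicator_one .of_discrete]
  congr 1
  funext y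
  have : ∑ x, (y + Pi.single i 1 : I → ℕ) x • e x = ∑ x, y x • e x + e i := by
    simp [add_smul, Finset.sum_add_distrib, Pi.single_apply]
  simp only [Set.indicator_apply, hA, Set.mem_preimage, Set.mem_singleton_iff, Set.mem_ofPred_eq, Pi.one_apply,
    this]

/-! ### The generating functional of the Poisson arrivals -/

section Arrivals

variable {Ω : Type*} {T : ℕ → Ω → ℝ≥0∞} {t : ℝ}

/-- `ENNReal.toReal` sends `∞` to `0 ∈ [0, t]`, so the clause `x ≠ ∞` is what excludes arrivals that
never occur. -/
theorem arrival_mem_Icc_iff (ht : 0 ≤ t) (x : ℝ≥0∞) :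
    (x ≠ ∞ ∧ x.toReal ∈ Set.Icc 0 t) ↔ x ≤ ENNReal.ofReal t := by
  constructor
  · rintro ⟨h1, h2⟩
    exact (ENNReal.le_ofReal_iff_toReal_le h1 ht).2 h2.2
  · intro h
    have h1 : x ≠ ∞ := ne_top_of_le_ne_top ENNReal.ofReal_ne_top h
    exact ⟨h1, ENNReal.toReal_nonneg, (ENNReal.le_ofReal_iff_toReal_le h1 ht).1 h⟩

/-- The product of `h` over the arrival times in `[0, t]`. -/
noncomputable def arrivalProd (T : ℕ → Ω → ℝ≥0∞) (t : ℝ) (h : ℝ → ℂ) (ω : Ω) : ℂ :=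
  ∏ᶠ i, if T i ω ≤ ENNReal.ofReal t then h (T i ω).toReal else 1

theorem arrivalProd_eq_prod (h : ℝ → ℂ) {ω : Ω} (hω : {i | T i ω ≤ ENNReal.ofReal t}.Finite) :
    arrivalProd T t h ω = ∏ i ∈ hω.toFinset, h (T i ω).toReal := by
  rw [arrivalProd, finprod_eq_prod_of_mulSupport_subset (s := hω.toFinset)]
  · refine Finset.prod_congr rfl fun i hi => ?_
    have : T i ω ≤ ENNReal.ofReal t := by simpa using hi
    simp [this]
  · intro i hi
    by_contra hc
    have : ¬ T i ω ≤ ENNReal.ofReal t := by simpa using hc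
    simp [this] at hi

theorem norm_arrivalProd_le {h : ℝ → ℂ} (hb : ∀ τ, ‖h τ‖ ≤ 1) {ω : Ω}
    (hω : {i | T i ω ≤ ENNReal.ofReal t}.Finite) : ‖arrivalProd T t h ω‖ ≤ 1 := by
  rw [arrivalProd_eq_prod h hω, norm_prod]
  exact Finset.prod_le_one (fun _ _ => norm_nonneg _) fun _ _ => hb _

/-- Grouping arrivals by the value of `g` turns the product into powers of counts on the fibres of
`g`. -/
theorem arrivalProd_simpleFunc (ht : 0 ≤ t) (g : SimpleFunc ℝ ℂ) {ω : Ω}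
    (hω : {i | T i ω ≤ ENNReal.ofReal t}.Finite) :
    arrivalProd T t g ω =
      ∏ c : g.range, (c : ℂ) ^ (arrivalCount T (Set.Icc 0 t ∩ g ⁻¹' {(c : ℂ)}) ω).toNat := by
  classical
  rw [arrivalProd_eq_prod _ hω, Finset.prod_coe_sort g.range
    fun c => c ^ (arrivalCount T (Set.Icc 0 t ∩ g ⁻¹' {(c : ℂ)}) ω).toNat,
    ← Finset.prod_fiberwise_of_maps_to' (t := g.range) (g := fun i => g (T i ω).toReal)
      (fun i _ => g.mem_range_self _) fun c => c]
  refine Finset.prod_congr rfl fun c _ => ?_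
  rw [Finset.prod_const]
  congr 1
  have : {i : ℕ | T i ω ≠ ∞ ∧ (T i ω).toReal ∈ Set.Icc 0 t ∩ g ⁻¹' {c}} =
      ({i ∈ hω.toFinset | g (T i ω).toReal = c} : Finset ℕ) := by
    ext i
    have := arrival_mem_Icc_iff ht (T i ω)
    simp only [Set.mem_ofPred_eq, Finset.coe_filter, Set.Finite.mem_toFinset, ← this, Set.mem_inter_iff,
      Set.mem_preimage, Set.mem_singleton_iff, and_assoc]
  rw [arrivalCount, this, Set.encard_coe_eq_coe_finsetCard, ENat.toNat_natCast]

variable [MeasurableSpace Ω] {P : Measure Ω} {lam : ℝ → ℝ}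

theorem IsPoissonArrivals.integrableOn (hT : IsPoissonArrivals P lam T) (ht : 0 ≤ t) :
    IntegrableOn lam (Set.Icc 0 t) :=
  (intervalIntegrable_iff_integrableOn_Icc_of_le ht).1 (hT.rate_integrable t ht)

theorem IsPoissonArrivals.ae_finite (hT : IsPoissonArrivals P lam T) (ht : 0 ≤ t) :
    ∀ᵐ ω ∂P, {i | T i ω ≤ ENNReal.ofReal t}.Finite := by
  have h := hT.poisson (Set.Icc 0 t) measurableSet_Icc (fun x hx => hx.1)
    (Metric.isBounded_Icc 0 t)
  have h2 : ∀ᵐ ω ∂P, arrivalCount T (Set.Icc 0 t) ω ≠ ⊤ := by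
    rw [h.ae_iff (p := fun m => m ≠ ⊤) .of_discrete, ae_map_iff (Measurable.of_discrete).aemeasurable
      .of_discrete]
    exact Filter.Eventually.of_forall fun m => ENat.natCast_ne_top m
  filter_upwards [h2] with ω hω
  simp only [arrivalCount, arrival_mem_Icc_iff ht] at hω
  exact Set.encard_ne_top_iff.1 hω

theorem IsPoissonArrivals.integral_pow_arrivalCount (hT : IsPoissonArrivals P lam T)
    {A : Set ℝ} (hA : MeasurableSet A) (hAt : A ⊆ Set.Icc 0 t) (z : ℂ) :
    ∫ ω, z ^ (arrivalCount T A ω).toNat ∂P = Complex.exp ((∫ τ in A, lam τ : ℝ) * (z - 1)) := by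
  have hA0 : A ⊆ Set.Ici 0 := fun x hx => (hAt hx).1
  have h := hT.poisson A hA hA0 ((Metric.isBounded_Icc 0 t).subset hAt)
  have h2 := h.integral_comp (f := fun m : ℕ∞ => z ^ m.toNat)
    (by exact (Measurable.of_discrete).aestronglyMeasurable)
  rw [integral_map (Measurable.of_discrete).aemeasurable
    (by exact (Measurable.of_discrete).aestronglyMeasurable)] at h2
  simp only [ENat.toNat_natCast, Function.comp_def] at h2
  rw [h2, integral_pow_poissonMeasure]
  have h0 : 0 ≤ ∫ τ in A, lam τ := setIntegral_nonneg hA fun τ hτ => hT.rate_nonneg τ (hA0 hτ)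
  congr 2
  exact congrArg _ (Real.coe_toNNReal _ h0)

/-- The fibres of `g` in `[0, t]` are disjoint, so their counts are independent Poisson variables;
the exponents of their generating functions add up to the integral of `λ (g - 1)`. -/
theorem IsPoissonArrivals.integral_arrivalProd_simpleFunc
    (hT : IsPoissonArrivals P lam T) (ht : 0 ≤ t) (g : SimpleFunc ℝ ℂ) :
    AEStronglyMeasurable (arrivalProd T t g) P ∧
    ∫ ω, arrivalProd T t g ω ∂P =
      Complex.exp (∫ τ in Set.Icc 0 t, (lam τ : ℂ) * (g τ - 1)) := by
  let A : g.range → Set ℝ := fun c => Set.Icc 0 t ∩ g ⁻¹' {(c : ℂ)}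
  have hA : ∀ c, MeasurableSet (A c) := fun c => measurableSet_Icc.inter (g.measurableSet_fiber _)
  have hAb : ∀ c, Bornology.IsBounded (A c) := fun c =>
    (Metric.isBounded_Icc 0 t).subset Set.inter_subset_left
  have hA0 : ∀ c, A c ⊆ Set.Ici 0 := fun c x hx => hx.1.1
  have hdisj : Pairwise fun c d => Disjoint (A c) (A d) := by
    intro c d hcd
    rw [Set.disjoint_left]
    rintro x ⟨_, h1⟩ ⟨_, h2⟩
    exact hcd (Subtype.ext (h1.symm.trans h2))
  have hind : iIndepFun (fun c : g.range => arrivalCount T (A c)) P := by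
    -- Independence is postulated for sequences indexed by `ℕ`, so the finite family of fibres is
    -- padded with empty sets.
    let e := Fintype.equivFin g.range
    let B : ℕ → Set ℝ := fun m => if hm : m < Fintype.card g.range then A (e.symm ⟨m, hm⟩) else ∅
    have hB := hT.indep B
      (fun m => by dsimp only [B]; split_ifs <;> simp [hA])
      (fun m => by dsimp only [B]; split_ifs <;> simp [hA0])
      (fun m => by dsimp only [B]; split_ifs <;> simp [hAb])
      (fun m m' hmm => by
        dsimp only [B]
        split_ifs
        · exact hdisj fun h => hmm (by simpa using h)
        all_goals simp)
    have := hB.precomp (g := fun c : g.range => (e c : ℕ))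
      (fun c d h => e.injective (Fin.ext h))
    have h2 : ∀ c, B (e c) = A c := fun c => by
      simp only [B, (e c).isLt, dite_true, Fin.eta, Equiv.symm_apply_apply]
    simpa [h2] using this
  have hmeas : ∀ c, AEMeasurable (arrivalCount T (A c)) P := fun c =>
    (hT.poisson (A c) (hA c) (hA0 c) (hAb c)).aemeasurable
  have hae : arrivalProd T t g =ᵐ[P]
      fun ω => ∏ c : g.range, (c : ℂ) ^ (arrivalCount T (A c) ω).toNat := by
    filter_upwards [hT.ae_finite ht] with ω hω
    exact arrivalProd_simpleFunc ht g hω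
  have hpm : ∀ c : g.range, Measurable fun m : ℕ∞ => (c : ℂ) ^ m.toNat := fun c => .of_discrete
  refine ⟨AEStronglyMeasurable.congr (Finset.aestronglyMeasurable_fun_prod _ fun c _ =>
    ((hpm c).comp_aemeasurable (hmeas c)).aestronglyMeasurable) hae.symm, ?_⟩
  rw [integral_congr_ae hae, hind.integral_fun_prod_comp (f := fun (c : g.range) m => (c : ℂ) ^ m.toNat) hmeas
    fun c => (hpm c).aestronglyMeasurable]
  simp_rw [hT.integral_pow_arrivalCount (hA _) Set.inter_subset_left]
  rw [← Complex.exp_sum]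
  congr 1
  have hpt : ∀ τ, (lam τ : ℂ) * (g τ - 1) =
      ∑ c : g.range, (g ⁻¹' {(c : ℂ)}).indicator (fun τ => (lam τ : ℂ) * (c - 1)) τ := by
    intro τ
    rw [Finset.sum_eq_single ⟨g τ, g.mem_range_self τ⟩]
    · simp
    · intro c _ hc
      rw [Set.indicator_of_notMem]
      intro h
      exact hc (Subtype.ext (show g τ = c from h).symm)
    · simp
  simp_rw [hpt]
  rw [integral_finsetSum]
  · refine Finset.sum_congr rfl fun c _ => ?_
    rw [setIntegral_indicator (g.measurableSet_fiber _), integral_mul_const, integral_complex_ofReal]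
  · intro c _
    exact (((hT.integrableOn ht).ofReal).mul_const _).indicator (g.measurableSet_fiber _)

/-- The probability generating functional of a Poisson process. -/
theorem IsPoissonArrivals.integral_arrivalProd [IsProbabilityMeasure P]
    (hT : IsPoissonArrivals P lam T) (ht : 0 ≤ t) {h : ℝ → ℂ} (hm : Measurable h)
    (hb : ∀ τ, ‖h τ‖ ≤ 1) :
    ∫ ω, arrivalProd T t h ω ∂P = Complex.exp (∫ τ in Set.Icc 0 t, (lam τ : ℂ) * (h τ - 1)) := by
  -- Approximating inside the closed unit ball keeps every arrival product bounded by `1`, as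
  -- dominated convergence requires.
  let g : ℕ → SimpleFunc ℝ ℂ := SimpleFunc.approxOn h hm (Metric.closedBall 0 1) 0 (by simp)
  have hgb : ∀ m τ, ‖g m τ‖ ≤ 1 := fun m τ => by
    simpa using SimpleFunc.approxOn_mem hm (s := Metric.closedBall 0 1) (y₀ := 0) (by simp) m τ
  have hgt : ∀ τ, Filter.Tendsto (fun m => g m τ) Filter.atTop (nhds (h τ)) := fun τ =>
    SimpleFunc.tendsto_approxOn hm _ (subset_closure (by simpa using hb τ))
  have h1 : Filter.Tendsto (fun m => ∫ ω, arrivalProd T t (g m) ω ∂P) Filter.atTop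
      (nhds (∫ ω, arrivalProd T t h ω ∂P)) := by
    refine tendsto_integral_of_dominated_convergence (fun _ => 1)
      (fun m => (hT.integral_arrivalProd_simpleFunc ht (g m)).1) (integrable_const _) ?_ ?_
    · intro m
      filter_upwards [hT.ae_finite ht] with ω hω using norm_arrivalProd_le (hgb m) hω
    · filter_upwards [hT.ae_finite ht] with ω hω
      simp_rw [arrivalProd_eq_prod _ hω]
      exact tendsto_finsetProd _ fun i _ => hgt _
  have h2 : Filter.Tendsto (fun m => ∫ τ in Set.Icc 0 t, (lam τ : ℂ) * (g m τ - 1)) Filter.atTop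
      (nhds (∫ τ in Set.Icc 0 t, (lam τ : ℂ) * (h τ - 1))) := by
    have hlam := hT.integrableOn ht
    refine tendsto_integral_of_dominated_convergence (fun τ => ‖lam τ‖ * 2) ?_
      (hlam.norm.mul_const 2) ?_ ?_
    · intro m
      exact hlam.ofReal.aestronglyMeasurable.mul
        ((g m).measurable.sub_const 1).aestronglyMeasurable
    · intro m
      refine Filter.Eventually.of_forall fun τ => ?_
      rw [norm_mul, Complex.norm_real]
      gcongr
      calc ‖g m τ - 1‖ ≤ ‖g m τ‖ + ‖(1 : ℂ)‖ := norm_sub_le _ _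
        _ ≤ 2 := by rw [norm_one]; linarith [hgb m τ]
    · exact Filter.Eventually.of_forall fun τ => ((hgt τ).sub_const 1).const_mul _
  refine tendsto_nhds_unique h1 ?_
  simp_rw [fun m => (hT.integral_arrivalProd_simpleFunc ht (g m)).2]
  exact (Complex.continuous_exp.tendsto _).comp h2

end Arrivals

/-! ### Expectations under independence -/

/-- Expectations with respect to a pair of independent random elements, computed by first
freezing one of them. -/
theorem integral_comp_prodMk_of_indepFun {Ω α β : Type*} [MeasurableSpace Ω] [MeasurableSpace α]
    [MeasurableSpace β] {P : Measure Ω} [IsProbabilityMeasure P] {U : Ω → α} {V : Ω → β}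
    (h : IndepFun U V P) (hU : Measurable U) (hV : Measurable V) {F : α × β → ℂ}
    (hF : Measurable F) (hb : ∀ x, ‖F x‖ ≤ 1) :
    ∫ ω, F (U ω, V ω) ∂P = ∫ ω, ∫ ω', F (U ω, V ω') ∂P ∂P := by
  have h1 := (indepFun_iff_map_prod_eq_prod_map_map hU.aemeasurable hV.aemeasurable).1 h
  have : IsProbabilityMeasure (P.map U) := Measure.isProbabilityMeasure_map hU.aemeasurable
  have : IsProbabilityMeasure (P.map V) := Measure.isProbabilityMeasure_map hV.aemeasurable
  rw [← integral_map (φ := fun ω => (U ω, V ω)) (hU.prodMk hV).aemeasurable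
    hF.aestronglyMeasurable, h1, integral_prod]
  · rw [integral_map hU.aemeasurable
      (hF.stronglyMeasurable.integral_prod_right' (ν := P.map V)).aestronglyMeasurable]
    congr 1
    funext ω
    exact integral_map hV.aemeasurable (hF.comp measurable_prodMk_left).aestronglyMeasurable
  · exact Integrable.of_bound hF.aestronglyMeasurable 1 (Filter.Eventually.of_forall hb)

/-- The expectation of a finite product of functions measurable with respect to independent
`σ`-algebras. -/
theorem integral_finsetProd_of_iIndep {Ω ι : Type*} {mΩ : MeasurableSpace Ω} {P : Measure Ω}
    {m : ι → MeasurableSpace Ω} (hm : ∀ i, m i ≤ mΩ) (h : iIndep m P) (s : Finset ι)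
    {f : ι → Ω → ℂ} (hf : ∀ i, Measurable[m i] (f i)) :
    ∫ ω, ∏ i ∈ s, f i ω ∂P = ∏ i ∈ s, ∫ ω, f i ω ∂P := by
  have h1 : iIndepFun f P := by
    rw [iIndepFun_iff_iIndep]
    exact iIndep_of_iIndep_of_le h fun i => (hf i).comap_le
  have h2 := h1.precomp (g := fun i : s => (i : ι)) Subtype.val_injective
  have h3 := h2.integral_fun_prod_eq_prod_integral
    fun i => ((hf i).mono (hm i) le_rfl).aestronglyMeasurable
  rw [← Finset.prod_coe_sort s fun i => ∫ ω, f i ω ∂P, ← h3]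
  congr 1
  funext ω
  exact (Finset.prod_coe_sort s fun i => f i ω).symm

/-! ### Contribution of a single batch -/

section Counts

variable {Ω : Type*} {J : ℕ}

/-- The number of customers in queue `k` at time `t` coming from batch `i`, if this batch arrives
at time `τ` and its sizes are `s`. -/
noncomputable def batchCount (X : ℕ → Fin J → ℕ → ℝ → Ω → Option (Fin J)) (t : ℝ) (i : ℕ) (τ : ℝ≥0∞)
    (s : Fin J → ℕ) (ω : Ω) (k : Fin J) : ℕ :=
  if τ ≤ ENNReal.ofReal t then
    ∑ j, ∑ l ∈ Finset.range (s j), if X i j l (t - τ.toReal) ω = some k then 1 else 0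
  else 0

theorem sub_toReal_nonneg {t : ℝ} (ht : 0 ≤ t) {τ : ℝ≥0∞} (h : τ ≤ ENNReal.ofReal t) :
    0 ≤ t - τ.toReal :=
  sub_nonneg.2 (ENNReal.toReal_le_of_le_ofReal ht h)

theorem measurable_batchCount [MeasurableSpace Ω] {X : ℕ → Fin J → ℕ → ℝ → Ω → Option (Fin J)}
    {t : ℝ} (ht : 0 ≤ t) {i : ℕ}
    (hX : ∀ j l k, MeasurableSet {x : ℝ × Ω | 0 ≤ x.1 ∧ X i j l x.1 x.2 = some k}) :
    Measurable fun x : (ℝ≥0∞ × (Fin J → ℕ)) × Ω => batchCount X t i x.1.1 x.1.2 x.2 := by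
  classical
  rw [measurable_pi_iff]
  intro k
  have hset : MeasurableSet {x : (ℝ≥0∞ × (Fin J → ℕ)) × Ω | x.1.1 ≤ ENNReal.ofReal t} :=
    measurableSet_le (by fun_prop) measurable_const
  -- The guard `τ ≤ t` goes inside the summand: route measurability is available only at ages `t - τ
  -- ≥ 0`.
  have hterm : ∀ j l, Measurable fun x : (ℝ≥0∞ × (Fin J → ℕ)) × Ω =>
      if x.1.1 ≤ ENNReal.ofReal t ∧ X i j l (t - x.1.1.toReal) x.2 = some k then 1 else 0 := by
    intro j l
    refine Measurable.ite ?_ measurable_const measurable_const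
    have hmap : Measurable fun x : (ℝ≥0∞ × (Fin J → ℕ)) × Ω => (t - x.1.1.toReal, x.2) := by
      fun_prop
    convert! hset.inter (hmap (hX j l k)) using 1
    ext x
    constructor
    · rintro ⟨h1, h2⟩
      exact ⟨h1, sub_toReal_nonneg ht h1, h2⟩
    · rintro ⟨h1, _, h2⟩
      exact ⟨h1, h2⟩
  have hrw : (fun x : (ℝ≥0∞ × (Fin J → ℕ)) × Ω => batchCount X t i x.1.1 x.1.2 x.2 k) =
      fun x => ∑ j, ∑ l ∈ Finset.range (x.1.2 j),
        if x.1.1 ≤ ENNReal.ofReal t ∧ X i j l (t - x.1.1.toReal) x.2 = some k then 1 else 0 := by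
    funext x
    by_cases h : x.1.1 ≤ ENNReal.ofReal t <;> simp [batchCount, h]
  rw [hrw]
  refine Finset.measurable_fun_sum _ fun j _ => ?_
  -- The number of summands varies with the point; it becomes a separate coordinate in the countable
  -- space `ℕ`, where it can be fixed.
  have h2 : Measurable fun y : ℕ × ((ℝ≥0∞ × (Fin J → ℕ)) × Ω) => ∑ l ∈ Finset.range y.1,
      if y.2.1.1 ≤ ENNReal.ofReal t ∧ X i j l (t - y.2.1.1.toReal) y.2.2 = some k then 1 else 0 :=
    measurable_from_prod_countable_right fun m =>
      Finset.measurable_fun_sum (Finset.range m) fun l _ => hterm j l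
  have h3 : Measurable fun x : (ℝ≥0∞ × (Fin J → ℕ)) × Ω => (x.1.2 j, x) := by fun_prop
  exact h2.comp h3

/-- Each customer contributes the factor `z k` when in queue `k` and `1` after leaving, which is
`Option.elim 1 z`. -/
theorem prod_pow_batchCount (X : ℕ → Fin J → ℕ → ℝ → Ω → Option (Fin J)) (t : ℝ) (i : ℕ)
    (τ : ℝ≥0∞) (s : Fin J → ℕ) (ω : Ω) (z : Fin J → ℂ) :
    ∏ k, z k ^ batchCount X t i τ s ω k = ∏ j, ∏ l ∈ Finset.range (s j),
      if τ ≤ ENNReal.ofReal t then (X i j l (t - τ.toReal) ω).elim 1 z else 1 := by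
  by_cases h : τ ≤ ENNReal.ofReal t
  · simp only [batchCount, h, if_true, ← Finset.prod_pow_eq_pow_sum]
    rw [Finset.prod_comm]
    refine Finset.prod_congr rfl fun j _ => ?_
    rw [Finset.prod_comm]
    refine Finset.prod_congr rfl fun l _ => ?_
    cases X i j l (t - τ.toReal) ω with
    | none => simp
    | some k => simp [pow_ite, Finset.prod_ite_eq]
  · simp [batchCount, h]

theorem norm_prod_pow_le {z : Fin J → ℂ} (hz : ∀ k, ‖z k‖ ≤ 1) (n : Fin J → ℕ) :
    ‖∏ k, z k ^ n k‖ ≤ 1 := by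
  rw [norm_prod]
  refine Finset.prod_le_one (fun _ _ => norm_nonneg _) fun k _ => ?_
  rw [norm_pow]
  exact pow_le_one₀ (norm_nonneg _) (hz k)

theorem occupancy_eq_sum {T : ℕ → Ω → ℝ≥0∞} {S : ℕ → Ω → Fin J → ℕ}
    {X : ℕ → Fin J → ℕ → ℝ → Ω → Option (Fin J)} {t : ℝ} {ω : Ω} {s : Finset ℕ}
    (hs : {i | T i ω ≤ ENNReal.ofReal t} ⊆ (s : Set ℕ)) :
    occupancy T S X t ω = ∑ i ∈ s, batchCount X t i (T i ω) (S i ω) ω := by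
  funext k
  rw [Finset.sum_apply]
  refine finsum_eq_sum_of_support_subset _ fun i hi => hs ?_
  by_contra hc
  have : ¬ T i ω ≤ ENNReal.ofReal t := hc
  simp [this] at hi

theorem eventually_subset_range {s : Set ℕ} (hs : s.Finite) :
    ∀ᶠ M in Filter.atTop, s ⊆ (Finset.range M : Set ℕ) := by
  obtain ⟨b, hb⟩ := hs.bddAbove
  filter_upwards [Filter.eventually_gt_atTop b] with M hM i hi
  simpa using (hb hi).trans_lt hM

/-- The probability generating function of the location, a time `u` after its arrival, of a
customer entering at queue `j` (extended by `1` to negative times). -/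
noncomputable def entryPgf (q : Fin J → Fin J → ℝ → ℝ) (z : Fin J → ℂ) (j : Fin J) (u : ℝ) : ℂ :=
  if 0 ≤ u then 1 + ∑ k, (q j k u : ℂ) * (z k - 1) else 1

theorem elim_one_eq (z : Fin J → ℂ) (o : Option (Fin J)) :
    o.elim 1 z = 1 + ∑ k, if o = some k then z k - 1 else 0 := by
  cases o <;> simp

theorem norm_elim_one_le {z : Fin J → ℂ} (hz : ∀ k, ‖z k‖ ≤ 1) (o : Option (Fin J)) :
    ‖o.elim 1 z‖ ≤ 1 := by
  cases o <;> simp [hz]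

end Counts

/-! ### Measurability and the law of one route -/

section Network

variable {Ω : Type*} [MeasurableSpace Ω] {P : Measure Ω} {J : ℕ}
  {lam : ℝ → ℝ} {q : Fin J → Fin J → ℝ → ℝ} {T : ℕ → Ω → ℝ≥0∞} {S : ℕ → Ω → Fin J → ℕ}
  {X : ℕ → Fin J → ℕ → ℝ → Ω → Option (Fin J)} {t : ℝ}

theorem IsNetwork.measurableSet_route (hnet : IsNetwork P lam q T S X) (i : ℕ) (j : Fin J) (l : ℕ)
    (k : Fin J) : MeasurableSet {x : ℝ × Ω | 0 ≤ x.1 ∧ X i j l x.1 x.2 = some k} := by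
  obtain ⟨𝒢, h𝒢, hX, -⟩ := hnet.independent
  exact sup_le_sup le_rfl (MeasurableSpace.comap_mono (h𝒢 i j l)) _ (hX i j l k)

theorem IsNetwork.measurableSet_location (hnet : IsNetwork P lam q T S X) (i : ℕ) (j : Fin J)
    (l : ℕ) (k : Fin J) {u : ℝ} (hu : 0 ≤ u) : MeasurableSet {ω | X i j l u ω = some k} := by
  have := measurable_prodMk_left (x := u) (hnet.measurableSet_route i j l k)
  simpa [Set.preimage, hu] using this

theorem IsNetwork.measurable_batchCount (hnet : IsNetwork P lam q T S X) (ht : 0 ≤ t) (i : ℕ) :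
    Measurable fun ω => batchCount X t i (T i ω) (S i ω) ω :=
  (BatchQueue.measurable_batchCount ht (hnet.measurableSet_route i)).comp
    (((hnet.arrivals.measurable i).prodMk (hnet.batch_measurable i)).prodMk measurable_id)

theorem IsNetwork.aemeasurable_occupancy (hnet : IsNetwork P lam q T S X) (ht : 0 ≤ t) :
    AEMeasurable (occupancy T S X t) P := by
  refine aemeasurable_of_tendsto_metrizable_ae Filter.atTop
    (f := fun M ω => ∑ i ∈ Finset.range M, batchCount X t i (T i ω) (S i ω) ω)
    (fun M => (Finset.measurable_fun_sum _ fun i _ => hnet.measurable_batchCount ht i).aemeasurable)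
    ?_
  filter_upwards [hnet.arrivals.ae_finite ht] with ω hω
  refine tendsto_const_nhds.congr' ?_
  filter_upwards [eventually_subset_range hω] with M hM using occupancy_eq_sum hM

variable [IsProbabilityMeasure P]

/-- No measurability of `q` is assumed; it follows because `q j k s` is the measure of the section
at `s` of a measurable route set. -/
theorem IsNetwork.measurable_location (hnet : IsNetwork P lam q T S X) (j k : Fin J) :
    Measurable fun s => if 0 ≤ s then q j k s else 0 := by
  have h := (measurable_measure_prodMk_left (ν := P)
    (hnet.measurableSet_route 0 j 0 k)).ennreal_toReal
  convert! h using 1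
  funext s
  by_cases hs : 0 ≤ s
  · simp only [hs, if_true, ← hnet.route_law 0 j 0 k s hs]
    simp [Measure.real, Set.preimage, hs]
  · simp [hs]

theorem IsNetwork.integral_route (hnet : IsNetwork P lam q T S X) (z : Fin J → ℂ) (i : ℕ)
    (j : Fin J) (l : ℕ) {u : ℝ} (hu : 0 ≤ u) :
    ∫ ω, (X i j l u ω).elim 1 z ∂P = entryPgf q z j u := by
  have hm := fun k => hnet.measurableSet_location i j l k hu
  have hind : ∀ k, {ω | X i j l u ω = some k}.indicator (fun _ => z k - 1) =
      fun ω => if X i j l u ω = some k then z k - 1 else 0 := fun k => by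
    funext ω
    simp [Set.indicator_apply]
  have hint : ∀ k, Integrable (fun ω => if X i j l u ω = some k then z k - 1 else 0) P := fun k =>
    hind k ▸ (integrable_const (z k - 1)).indicator (hm k)
  simp_rw [elim_one_eq]
  rw [integral_add (integrable_const _) (integrable_finsetSum _ fun k _ => hint k),
    integral_finsetSum _ fun k _ => hint k, entryPgf, if_pos hu]
  congr 1
  · simp
  · refine Finset.sum_congr rfl fun k _ => ?_
    have := integral_indicator_const (μ := P) (z k - 1) (hm k)
    rw [hnet.route_law i j l k u hu, Complex.real_smul, hind k] at this
    exact this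

theorem IsNetwork.norm_entryPgf_le (hnet : IsNetwork P lam q T S X) {z : Fin J → ℂ}
    (hz : ∀ k, ‖z k‖ ≤ 1) (j : Fin J) (u : ℝ) : ‖entryPgf q z j u‖ ≤ 1 := by
  by_cases hu : 0 ≤ u
  · rw [← hnet.integral_route z 0 j 0 hu]
    refine (norm_integral_le_of_norm_le_const (C := 1)
      (Filter.Eventually.of_forall fun ω => norm_elim_one_le hz _)).trans (by simp)
  · simp [entryPgf, hu]

theorem IsNetwork.measurable_entryPgf (hnet : IsNetwork P lam q T S X) (z : Fin J → ℂ)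
    (j : Fin J) : Measurable (entryPgf q z j) := by
  have h : entryPgf q z j =
      fun u => 1 + ∑ k, (((if 0 ≤ u then q j k u else 0 : ℝ)) : ℂ) * (z k - 1) := by
    funext u
    by_cases hu : 0 ≤ u <;> simp [hu, entryPgf]
  rw [h]
  refine measurable_const.add (Finset.measurable_fun_sum _ fun k _ => ?_)
  exact (Complex.measurable_ofReal.comp (hnet.measurable_location j k)).mul_const _

end Network

/-! ### Averaging over routes, batches and arrivals -/

theorem comap_pi_le {Ω ι : Type*} {β : ι → Type*} [∀ i, MeasurableSpace (β i)]
    {m : MeasurableSpace Ω} {f : ∀ i, Ω → β i}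
    (h : ∀ i, MeasurableSpace.comap (f i) inferInstance ≤ m) :
    MeasurableSpace.comap (fun ω i => f i ω) inferInstance ≤ m :=
  measurable_iff_comap_le.1 (measurable_pi_iff.2 fun i => measurable_iff_comap_le.2 (h i))

theorem comap_prodMk_le {Ω α β : Type*} [MeasurableSpace α] [MeasurableSpace β]
    {m : MeasurableSpace Ω} {f : Ω → α} {g : Ω → β}
    (hf : MeasurableSpace.comap f inferInstance ≤ m)
    (hg : MeasurableSpace.comap g inferInstance ≤ m) :
    MeasurableSpace.comap (fun ω => (f ω, g ω)) inferInstance ≤ m :=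
  measurable_iff_comap_le.1
    ((measurable_iff_comap_le.2 hf).prodMk (measurable_iff_comap_le.2 hg))

/-- Expectations of functions of a random element `U` and of an outcome depending only on
information independent of `U`, computed by first freezing `U`. -/
theorem integral_freeze_of_indep {Ω α : Type*} {m mΩ : MeasurableSpace Ω} [MeasurableSpace α]
    {P : Measure Ω} [IsProbabilityMeasure P] {U : Ω → α} (hm : m ≤ mΩ)
    (h : Indep (MeasurableSpace.comap U inferInstance) m P) (hU : Measurable U) {F : α × Ω → ℂ}
    (hF : Measurable[MeasurableSpace.prod inferInstance m] F) (hb : ∀ x, ‖F x‖ ≤ 1) :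
    ∫ ω, F (U ω, ω) ∂P = ∫ ω, ∫ ω', F (U ω, ω') ∂P ∂P := by
  -- The second random element is the identity, seen as a map from `Ω` to `Ω` with the smaller
  -- `σ`-algebra `m`.
  refine @integral_comp_prodMk_of_indepFun Ω α Ω mΩ _ m P _ U id ?_ hU
    (measurable_id'' hm) F hF hb
  rw [@IndepFun_iff_Indep Ω α Ω mΩ _ m U id P, MeasurableSpace.comap_id]
  exact h

section Network

variable {Ω : Type*} {J : ℕ}
  {lam : ℝ → ℝ} {q : Fin J → Fin J → ℝ → ℝ} {T : ℕ → Ω → ℝ≥0∞} {S : ℕ → Ω → Fin J → ℕ}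
  {X : ℕ → Fin J → ℕ → ℝ → Ω → Option (Fin J)} {t : ℝ}

/-- The `σ`-algebra generated by all routes. -/
@[reducible] def routeSigma (T : ℕ → Ω → ℝ≥0∞) (S : ℕ → Ω → Fin J → ℕ)
    (𝒢 : ℕ → Fin J → ℕ → MeasurableSpace Ω) : MeasurableSpace Ω :=
  ⨆ a ∈ {a : Source J | ∃ i j l, a = .route i j l}, sourceSigma T S 𝒢 a

theorem le_routeSigma (𝒢 : ℕ → Fin J → ℕ → MeasurableSpace Ω) (i : ℕ) (j : Fin J) (l : ℕ) :
    𝒢 i j l ≤ routeSigma T S 𝒢 :=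
  le_iSup₂_of_le (f := fun a (_ : a ∈ {a : Source J | ∃ i j l, a = .route i j l}) =>
    sourceSigma T S 𝒢 a) (.route i j l) ⟨i, j, l, rfl⟩ le_rfl

variable [mΩ : MeasurableSpace Ω] {P : Measure Ω}

theorem sourceSigma_le {𝒢 : ℕ → Fin J → ℕ → MeasurableSpace Ω} (hT : ∀ i, Measurable (T i))
    (hS : ∀ i, Measurable (S i)) (h𝒢 : ∀ i j l, 𝒢 i j l ≤ mΩ) (a : Source J) :
    sourceSigma T S 𝒢 a ≤ mΩ := by
  cases a with
  | arrivals => exact (measurable_pi_iff.2 hT).comap_le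
  | batch i => exact (hS i).comap_le
  | route i j l => exact h𝒢 i j l

theorem indep_arrivals_batches_routes {𝒢 : ℕ → Fin J → ℕ → MeasurableSpace Ω}
    (hle : ∀ a, sourceSigma T S 𝒢 a ≤ mΩ) (hind : iIndep (sourceSigma T S 𝒢) P) :
    Indep (MeasurableSpace.comap (fun ω => ((fun i => T i ω), fun i => S i ω)) inferInstance)
      (routeSigma T S 𝒢) P := by
  let A : Set (Source J) := {a | ∃ i j l, a = .route i j l}
  refine indep_of_indep_of_le_left (indep_iSup_of_disjoint hle hind
    (disjoint_compl_left : Disjoint Aᶜ A)) (comap_prodMk_le ?_ (comap_pi_le fun i => ?_))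
  · exact le_iSup₂_of_le (f := fun a (_ : a ∈ Aᶜ) => sourceSigma T S 𝒢 a) .arrivals
      (by simp [A]) le_rfl
  · exact le_iSup₂_of_le (f := fun a (_ : a ∈ Aᶜ) => sourceSigma T S 𝒢 a) (.batch i)
      (by simp [A]) le_rfl

theorem indepFun_arrivals_batches {𝒢 : ℕ → Fin J → ℕ → MeasurableSpace Ω}
    (hle : ∀ a, sourceSigma T S 𝒢 a ≤ mΩ) (hind : iIndep (sourceSigma T S 𝒢) P) :
    IndepFun (fun ω i => T i ω) (fun ω i => S i ω) P := by
  rw [IndepFun_iff_Indep]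
  let A : Set (Source J) := {.arrivals}
  refine indep_of_indep_of_le (indep_iSup_of_disjoint hle hind
    (disjoint_compl_right : Disjoint A Aᶜ)) ?_ (comap_pi_le fun i => ?_)
  · exact le_iSup₂_of_le (f := fun a (_ : a ∈ A) => sourceSigma T S 𝒢 a) .arrivals
      (by simp [A]) le_rfl
  · exact le_iSup₂_of_le (f := fun a (_ : a ∈ Aᶜ) => sourceSigma T S 𝒢 a) (.batch i)
      (by simp [A]) le_rfl

theorem measurable_prod_batchCount (ht : 0 ≤ t)
    (hX : ∀ i j l k, MeasurableSet {x : ℝ × Ω | 0 ≤ x.1 ∧ X i j l x.1 x.2 = some k})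
    (z : Fin J → ℂ) (M : ℕ) :
    Measurable fun x : ((ℕ → ℝ≥0∞) × (ℕ → Fin J → ℕ)) × Ω =>
      ∏ i ∈ Finset.range M, ∏ k, z k ^ batchCount X t i (x.1.1 i) (x.1.2 i) x.2 k := by
  refine Finset.measurable_fun_prod _ fun i _ => ?_
  have h0 : Measurable fun n : Fin J → ℕ => ∏ k, z k ^ n k := .of_discrete
  have h1 : Measurable fun x : ((ℕ → ℝ≥0∞) × (ℕ → Fin J → ℕ)) × Ω =>
      ((x.1.1 i, x.1.2 i), x.2) := by fun_prop
  exact h0.comp ((measurable_batchCount ht (hX i)).comp h1)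

variable [IsProbabilityMeasure P]

/-- The expectation over the routes, the arrival times and the batch sizes being frozen. -/
theorem integral_routes (hX : ∀ i j l u, 0 ≤ u → ∀ z : Fin J → ℂ,
      ∫ ω, (X i j l u ω).elim 1 z ∂P = entryPgf q z j u)
    {𝒢 : ℕ → Fin J → ℕ → MeasurableSpace Ω} (h𝒢 : ∀ i j l, 𝒢 i j l ≤ mΩ)
    (h𝒢X : ∀ i j l k, MeasurableSet[(borel ℝ).prod (𝒢 i j l)]
      {x : ℝ × Ω | 0 ≤ x.1 ∧ X i j l x.1 x.2 = some k})
    (hind : iIndep (fun x : Σ _ : ℕ, Σ _ : Fin J, ℕ => 𝒢 x.1 x.2.1 x.2.2) P)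
    (ht : 0 ≤ t) (z : Fin J → ℂ) (M : ℕ) (τ : ℕ → ℝ≥0∞) (s : ℕ → Fin J → ℕ) :
    ∫ ω, ∏ i ∈ Finset.range M, ∏ k, z k ^ batchCount X t i (τ i) (s i) ω k ∂P =
      ∏ i ∈ Finset.range M, if τ i ≤ ENNReal.ofReal t then
        ∏ j, entryPgf q z j (t - (τ i).toReal) ^ s i j else 1 := by
  let f : (Σ _ : ℕ, Σ _ : Fin J, ℕ) → Ω → ℂ := fun x ω =>
    if τ x.1 ≤ ENNReal.ofReal t then (X x.1 x.2.1 x.2.2 (t - (τ x.1).toReal) ω).elim 1 z else 1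
  have hf : ∀ x, Measurable[𝒢 x.1 x.2.1 x.2.2] (f x) := by
    intro x
    by_cases hx : τ x.1 ≤ ENNReal.ofReal t
    · have hu := sub_toReal_nonneg ht hx
      simp only [f, hx, if_true, elim_one_eq]
      -- Independence of the factors needs measurability for each route's own `σ`-algebra, not only
      -- for the ambient one.
      let : MeasurableSpace Ω := 𝒢 x.1 x.2.1 x.2.2
      refine measurable_const.add (Finset.measurable_fun_sum _ fun k _ => ?_)
      refine Measurable.ite ?_ measurable_const measurable_const
      have h0 : MeasurableSet {y : ℝ × Ω | 0 ≤ y.1 ∧ X x.1 x.2.1 x.2.2 y.1 y.2 = some k} :=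
        h𝒢X x.1 x.2.1 x.2.2 k
      have := measurable_prodMk_left (x := t - (τ x.1).toReal) h0
      simpa [Set.preimage, hu] using this
    · simp only [f, hx, if_false]
      exact @measurable_const _ _ _ (𝒢 x.1 x.2.1 x.2.2) _
  have hprod : ∀ g : (Σ _ : ℕ, Σ _ : Fin J, ℕ) → ℂ,
      ∏ x ∈ (Finset.range M).sigma fun i => Finset.univ.sigma fun j => Finset.range (s i j), g x =
        ∏ i ∈ Finset.range M, ∏ j, ∏ l ∈ Finset.range (s i j), g ⟨i, j, l⟩ := by
    intro g
    rw [Finset.prod_sigma]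
    exact Finset.prod_congr rfl fun i _ => Finset.prod_sigma _ _ _
  have h1 := integral_finsetProd_of_iIndep (fun x => h𝒢 x.1 x.2.1 x.2.2) hind
    ((Finset.range M).sigma fun i => Finset.univ.sigma fun j => Finset.range (s i j)) hf
  simp_rw [hprod] at h1
  simp_rw [prod_pow_batchCount]
  refine h1.trans (Finset.prod_congr rfl fun i _ => ?_)
  by_cases hi : τ i ≤ ENNReal.ofReal t
  · simp only [f, hi, if_true, hX i _ _ _ (sub_toReal_nonneg ht hi), Finset.prod_const,
      Finset.card_range]
  · simp [f, hi]

/-- Average over routes with arrivals and sizes frozen, then over the independent size vectors with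
arrivals frozen. Restricting to the first `M` batches keeps the products finite. -/
theorem IsNetwork.integral_prod_batchCount (hnet : IsNetwork P lam q T S X) (ht : 0 ≤ t)
    {z : Fin J → ℂ} (hz : ∀ k, ‖z k‖ ≤ 1) (M : ℕ) :
    ∫ ω, ∏ i ∈ Finset.range M, ∏ k, z k ^ batchCount X t i (T i ω) (S i ω) ω k ∂P =
      ∫ ω, ∏ i ∈ Finset.range M, (if T i ω ≤ ENNReal.ofReal t then
        vectorPgf P (S 0) fun j => entryPgf q z j (t - (T i ω).toReal) else 1) ∂P := by
  obtain ⟨𝒢, h𝒢, h𝒢X, hind⟩ := hnet.independent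
  have hle := sourceSigma_le hnet.arrivals.measurable hnet.batch_measurable h𝒢
  have hTm : Measurable fun ω i => T i ω := measurable_pi_iff.2 hnet.arrivals.measurable
  have hSm : Measurable fun ω i => S i ω := measurable_pi_iff.2 hnet.batch_measurable
  have hTS := indepFun_arrivals_batches hle hind
  have hSS : iIndep (fun i => MeasurableSpace.comap (S i) inferInstance) P :=
    hind.precomp (g := fun i : ℕ => (.batch i : Source J)) fun i i' h => by simpa using h
  have hRR : iIndep (fun x : Σ _ : ℕ, Σ _ : Fin J, ℕ => 𝒢 x.1 x.2.1 x.2.2) P :=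
    hind.precomp (g := fun x : Σ _ : ℕ, Σ _ : Fin J, ℕ => (.route x.1 x.2.1 x.2.2 : Source J)) <| by
      rintro ⟨i, j, l⟩ ⟨i', j', l'⟩ h
      simp only [Source.route.injEq] at h
      obtain ⟨rfl, rfl, rfl⟩ := h
      rfl
  have step₁ := integral_freeze_of_indep (iSup₂_le fun a _ => hle a)
    (indep_arrivals_batches_routes hle hind) (hTm.prodMk hSm)
    (@measurable_prod_batchCount Ω J X t (routeSigma T S 𝒢) ht (fun i j l k =>
      sup_le_sup le_rfl (MeasurableSpace.comap_mono (le_routeSigma 𝒢 i j l)) _ (h𝒢X i j l k)) z M)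
    (fun x => by
      rw [norm_prod]
      exact Finset.prod_le_one (fun _ _ => norm_nonneg _) fun i _ => norm_prod_pow_le hz _)
  rw [step₁]
  simp_rw [integral_routes (fun i j l u hu z => hnet.integral_route z i j l hu) h𝒢 h𝒢X hRR ht z M]
  have hw := hnet.norm_entryPgf_le hz
  have step₂ := integral_comp_prodMk_of_indepFun hTS hTm hSm
    (F := fun x => ∏ i ∈ Finset.range M, if x.1 i ≤ ENNReal.ofReal t then
        ∏ j, entryPgf q z j (t - (x.1 i).toReal) ^ x.2 i j else 1)
    (by
      refine Finset.measurable_fun_prod _ fun i _ => Measurable.ite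
        (measurableSet_le (by fun_prop) measurable_const) ?_ measurable_const
      refine Finset.measurable_fun_prod _ fun j _ => Measurable.pow ?_ (by fun_prop)
      exact (hnet.measurable_entryPgf z j).comp (by fun_prop))
    (fun x => by
      rw [norm_prod]
      refine Finset.prod_le_one (fun _ _ => norm_nonneg _) fun i _ => ?_
      split_ifs
      · exact norm_prod_pow_le (fun j => hw j _) _
      · simp)
  rw [step₂]
  congr 1
  funext ω
  have step₃ := integral_finsetProd_of_iIndep (P := P) (fun i => (hnet.batch_measurable i).comap_le)
    hSS (Finset.range M) (f := fun i ω' => if T i ω ≤ ENNReal.ofReal t then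
        ∏ j, entryPgf q z j (t - (T i ω).toReal) ^ S i ω' j else 1)
    (fun i => by
      have h0 : Measurable fun n : Fin J → ℕ => if T i ω ≤ ENNReal.ofReal t then
        ∏ j, entryPgf q z j (t - (T i ω).toReal) ^ n j else 1 := .of_discrete
      exact h0.comp (comap_measurable (S i)))
  rw [step₃]
  refine Finset.prod_congr rfl fun i _ => ?_
  split_ifs
  · have h0 : Measurable fun n : Fin J → ℕ => ∏ j, entryPgf q z j (t - (T i ω).toReal) ^ n j :=
      .of_discrete
    exact ((hnet.batch_identDistrib i).comp h0).integral_eq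
  · simp

/-- The joint probability generating function of the numbers of customers in the queues. -/
theorem IsNetwork.integral_prod_pow_occupancy (hnet : IsNetwork P lam q T S X) (ht : 0 ≤ t)
    {z : Fin J → ℂ} (hz : ∀ k, ‖z k‖ ≤ 1) :
    ∫ ω, ∏ k, z k ^ occupancy T S X t ω k ∂P =
      Complex.exp (∫ τ in Set.Icc 0 t, (lam τ : ℂ) *
        (vectorPgf P (S 0) (fun j => entryPgf q z j (t - τ)) - 1)) := by
  let h : ℝ → ℂ := fun τ => vectorPgf P (S 0) fun j => entryPgf q z j (t - τ)
  have hw := hnet.norm_entryPgf_le hz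
  have hb : ∀ τ, ‖h τ‖ ≤ 1 := fun τ =>
    (norm_integral_le_of_norm_le_const (C := 1)
      (Filter.Eventually.of_forall fun ω => norm_prod_pow_le (fun j => hw j _) _)).trans (by simp)
  have hm : Measurable h := by
    have : Measurable fun x : ℝ × Ω => ∏ j, entryPgf q z j (t - x.1) ^ S 0 x.2 j := by
      refine Finset.measurable_fun_prod _ fun j _ => Measurable.pow ?_ ?_
      · exact (hnet.measurable_entryPgf z j).comp (by fun_prop)
      · exact (measurable_pi_apply j).comp ((hnet.batch_measurable 0).comp measurable_snd)
    exact this.stronglyMeasurable.integral_prod_right'.measurable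
  rw [← hnet.arrivals.integral_arrivalProd ht hm hb]
  have hle : ∀ c : Prop, ∀ [Decidable c] x, ‖if c then h x else 1‖ ≤ 1 := by
    intro c _ x
    split_ifs
    · exact hb x
    · simp
  -- Almost surely finitely many batches arrive by time `t`, so here and in `lim₂` the truncated
  -- products are eventually constant in `M`, and they are bounded by `1`.
  have lim₁ : Filter.Tendsto (fun M => ∫ ω, ∏ i ∈ Finset.range M,
      ∏ k, z k ^ batchCount X t i (T i ω) (S i ω) ω k ∂P) Filter.atTop
      (nhds (∫ ω, ∏ k, z k ^ occupancy T S X t ω k ∂P)) := by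
    refine tendsto_integral_of_dominated_convergence (fun _ => 1) (fun M => ?_)
      (integrable_const _) (fun M => Filter.Eventually.of_forall fun ω => ?_) ?_
    · refine (Finset.measurable_fun_prod _ fun i _ => ?_).aestronglyMeasurable
      have h0 : Measurable fun n : Fin J → ℕ => ∏ k, z k ^ n k := .of_discrete
      exact h0.comp (hnet.measurable_batchCount ht i)
    · rw [norm_prod]
      exact Finset.prod_le_one (fun _ _ => norm_nonneg _) fun i _ => norm_prod_pow_le hz _
    · filter_upwards [hnet.arrivals.ae_finite ht] with ω hω
      refine tendsto_const_nhds.congr' ?_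
      filter_upwards [eventually_subset_range hω] with M hM
      rw [occupancy_eq_sum hM, Finset.prod_comm]
      refine Finset.prod_congr rfl fun k _ => ?_
      rw [Finset.sum_apply, Finset.prod_pow_eq_pow_sum]
  have lim₂ : Filter.Tendsto (fun M => ∫ ω, ∏ i ∈ Finset.range M,
      (if T i ω ≤ ENNReal.ofReal t then h (T i ω).toReal else 1) ∂P) Filter.atTop
      (nhds (∫ ω, arrivalProd T t h ω ∂P)) := by
    refine tendsto_integral_of_dominated_convergence (fun _ => 1) (fun M => ?_)
      (integrable_const _) (fun M => Filter.Eventually.of_forall fun ω => ?_) ?_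
    · refine (Finset.measurable_fun_prod _ fun i _ => ?_).aestronglyMeasurable
      have hTi := hnet.arrivals.measurable i
      exact Measurable.ite (measurableSet_le hTi measurable_const) (hm.comp hTi.ennreal_toReal)
        measurable_const
    · rw [norm_prod]
      exact Finset.prod_le_one (fun _ _ => norm_nonneg _) fun i _ => hle _ _
    · filter_upwards [hnet.arrivals.ae_finite ht] with ω hω
      refine tendsto_const_nhds.congr' ?_
      filter_upwards [eventually_subset_range hω] with M hM
      refine finprod_eq_prod_of_mulSupport_subset _ fun i hi => hM ?_
      by_contra hc
      have : ¬ T i ω ≤ ENNReal.ofReal t := hc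
      simp [this] at hi
  refine tendsto_nhds_unique lim₁ ?_
  simp_rw [hnet.integral_prod_batchCount ht hz]
  exact lim₂

end Network

/-! ### Multinomial expansion of the binomial batch -/

section Kernel

variable {J : ℕ}

/-- The expression `binomialKernel`, with an arbitrary set `s` of queues in place of `Finset.Iic v`. -/
noncomputable def kernelOn (s : Finset (Fin J)) (N : ℕ) (α : ℝ) (r : Fin J → ℝ) (i : Fin J → ℕ) :
    ℝ :=
  (N.factorial : ℝ) / ((N - ∑ k ∈ s, i k).factorial : ℝ)
    * (1 - α * ∑ k, r k) ^ (N - ∑ k ∈ s, i k)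
    * ∏ k ∈ s, (α * r k) ^ i k / ((i k).factorial : ℝ)

theorem kernelOn_eq_univ {s : Finset (Fin J)} {i : Fin J → ℕ} (hi : ∀ k ∉ s, i k = 0) (N : ℕ)
    (α : ℝ) (r : Fin J → ℝ) : kernelOn s N α r i = kernelOn Finset.univ N α r i := by
  have h1 : ∑ k ∈ s, i k = ∑ k, i k :=
    Finset.sum_subset (Finset.subset_univ s) fun k _ hk => hi k hk
  have h2 : ∏ k ∈ s, (α * r k) ^ i k / ((i k).factorial : ℝ) =
      ∏ k, (α * r k) ^ i k / ((i k).factorial : ℝ) :=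
    Finset.prod_subset (Finset.subset_univ s) fun k _ hk => by simp [hi k hk]
  rw [kernelOn, kernelOn, h1, h2]

theorem kernelOn_nonneg (s : Finset (Fin J)) (N : ℕ) {α : ℝ} {r : Fin J → ℝ} (i : Fin J → ℕ)
    (hα : 0 ≤ α) (hr : ∀ k, 0 ≤ r k) (hαr : α * ∑ k, r k ≤ 1) : 0 ≤ kernelOn s N α r i := by
  have h1 : 0 ≤ 1 - α * ∑ k, r k := sub_nonneg.2 hαr
  have h2 : ∀ k, 0 ≤ α * r k := fun k => mul_nonneg hα (hr k)
  unfold kernelOn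
  have := Finset.prod_nonneg (s := s) (f := fun k => (α * r k) ^ i k / ((i k).factorial : ℝ))
    fun k _ => div_nonneg (pow_nonneg (h2 k) _) (by positivity)
  positivity

/-- A bound free of `r`, so that integrability of the rate carries over. It also covers `∑ i_k > N`,
where the truncated subtraction gives `0`. -/
theorem kernelOn_le (s : Finset (Fin J)) (N : ℕ) {α : ℝ} {r : Fin J → ℝ} (i : Fin J → ℕ)
    (hα : 0 ≤ α) (hr : ∀ k, 0 ≤ r k) (hαr : α * ∑ k, r k ≤ 1) :
    kernelOn s N α r i ≤ N.factorial := by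
  have h1 : 0 ≤ 1 - α * ∑ k, r k := sub_nonneg.2 hαr
  have h2 : ∀ k, 0 ≤ α * r k := fun k => mul_nonneg hα (hr k)
  have h3 : ∀ k, α * r k ≤ 1 := fun k => le_trans (mul_le_mul_of_nonneg_left
    (Finset.single_le_sum (fun k _ => hr k) (Finset.mem_univ k)) hα) hαr
  have h4 : 1 - α * ∑ k, r k ≤ 1 :=
    sub_le_self _ (mul_nonneg hα (Finset.sum_nonneg fun k _ => hr k))
  have hfac : ∀ m : ℕ, (1 : ℝ) ≤ m.factorial := fun m => by
    exact_mod_cast Nat.one_le_iff_ne_zero.2 m.factorial_ne_zero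
  have h5 : ∏ k ∈ s, (α * r k) ^ i k / ((i k).factorial : ℝ) ≤ 1 :=
    Finset.prod_le_one (fun k _ => div_nonneg (pow_nonneg (h2 k) _) (by positivity)) fun k _ =>
      div_le_one_of_le₀ ((pow_le_one₀ (h2 k) (h3 k)).trans (hfac _)) (by positivity)
  have h6 : (N.factorial : ℝ) / ((N - ∑ k ∈ s, i k).factorial : ℝ) ≤ N.factorial :=
    div_le_self (by positivity) (hfac _)
  unfold kernelOn
  calc _ ≤ (N.factorial : ℝ) * 1 * 1 := by
        gcongr
        · exact Finset.prod_nonneg fun k _ => div_nonneg (pow_nonneg (h2 k) _) (by positivity)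
        · exact pow_le_one₀ h1 h4
    _ = _ := by ring

/-- The vectors of batch contributions with at most `N` customers in total. -/
def contributions (J N : ℕ) : Finset (Fin J → ℕ) :=
  (Finset.range (N + 1)).biUnion fun m => Finset.piAntidiag Finset.univ m

theorem mem_contributions {N : ℕ} {i : Fin J → ℕ} : i ∈ contributions J N ↔ ∑ k, i k ≤ N := by
  simp [contributions]

/-- Binomial expansion, then multinomial expansion of each power `m`: the coefficient `N! / ((N -
m)! ∏ i_k!)` is `N.choose m` times the multinomial coefficient. -/
theorem sum_kernelOn_mul_prod_pow (N : ℕ) (α : ℝ) (r : Fin J → ℝ) (z : Fin J → ℂ) :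
    ∑ i ∈ contributions J N, (kernelOn Finset.univ N α r i : ℂ) * ∏ k, z k ^ i k =
      ((1 - α * ∑ k, r k : ℝ) + ∑ k, ((α * r k : ℝ) : ℂ) * z k) ^ N := by
  rw [contributions, Finset.sum_biUnion,
    add_comm _ (∑ k, ((α * r k : ℝ) : ℂ) * z k), add_pow]
  · refine Finset.sum_congr rfl fun m hm => ?_
    have hmN : m ≤ N := Nat.lt_succ_iff.1 (Finset.mem_range.1 hm)
    rw [Finset.sum_pow_eq_sum_piAntidiag, Finset.sum_mul, Finset.sum_mul]
    refine Finset.sum_congr rfl fun i hi => ?_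
    have him : ∑ k, i k = m := by simpa using hi
    have hmul := Nat.multinomial_spec Finset.univ i
    rw [him] at hmul
    have hch := Nat.choose_mul_factorial_mul_factorial hmN
    have hprod : ((∏ k, (i k).factorial : ℕ) : ℂ) ≠ 0 := by
      exact_mod_cast Finset.prod_ne_zero_iff.2 fun k _ => (i k).factorial_ne_zero
    have hNm : (((N - m).factorial : ℕ) : ℂ) ≠ 0 := by exact_mod_cast (N - m).factorial_ne_zero
    have hcoef : (N.factorial : ℂ) / ((N - m).factorial : ℂ) / ((∏ k, (i k).factorial : ℕ) : ℂ) =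
        Nat.multinomial Finset.univ i * N.choose m := by
      rw [div_div, div_eq_iff (mul_ne_zero hNm hprod), ← hch, ← hmul]
      push_cast
      ring
    simp only [kernelOn, him]
    push_cast
    rw [Finset.prod_div_distrib]
    simp_rw [mul_pow (_ * _ : ℂ)]
    rw [Finset.prod_mul_distrib]
    push_cast at hcoef
    linear_combination ((1 - α * ∑ k, (r k : ℂ)) ^ (N - m) * (∏ k, ((α : ℂ) * r k) ^ i k) *
      ∏ k, z k ^ i k) * hcoef
  · intro m _ m' _ hmm
    rw [Function.onFun, Finset.disjoint_left]
    intro i hi hi'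
    simp only [Finset.mem_piAntidiag] at hi hi'
    exact hmm (hi.1.symm.trans hi'.1)

theorem sum_kernelOn (N : ℕ) (α : ℝ) (r : Fin J → ℝ) :
    ∑ i ∈ contributions J N, kernelOn Finset.univ N α r i = 1 := by
  have h := sum_kernelOn_mul_prod_pow N α r fun _ => 1
  simp only [one_pow, Finset.prod_const_one, mul_one] at h
  rw [← Complex.ofReal_sum, ← Complex.ofReal_sum, ← Finset.mul_sum, ← Complex.ofReal_add,
    sub_add_cancel, Complex.ofReal_one, one_pow] at h
  exact_mod_cast h

theorem pgf_binomial (N : ℕ) (α : unitInterval) (w : ℂ) :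
    pgf (binomial N α) w = (1 - (α : ℝ) + (α : ℝ) * w) ^ N := by
  rw [pgf, integral_binomial, add_comm (1 - _ : ℂ), add_pow, Nat.range_succ_eq_Iic]
  refine Finset.sum_congr rfl fun m _ => ?_
  rw [Complex.real_smul]
  push_cast
  ring

end Kernel

/-! ### The compound Poisson law of the occupancy and its recurrence -/

section Network

variable {Ω : Type*} [MeasurableSpace Ω] {P : Measure Ω} {J : ℕ}
  {lam : ℝ → ℝ} {q : Fin J → Fin J → ℝ → ℝ} {T : ℕ → Ω → ℝ≥0∞} {S : ℕ → Ω → Fin J → ℕ}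
  {X : ℕ → Fin J → ℕ → ℝ → Ω → Option (Fin J)} {t : ℝ} {p : Fin J → ℝ}

theorem IsNetwork.mixedLocation_nonneg (hnet : IsNetwork P lam q T S X) (hp : ∀ j, 0 ≤ p j)
    (k : Fin J) {u : ℝ} (hu : 0 ≤ u) : 0 ≤ mixedLocation p q k u :=
  Finset.sum_nonneg fun j _ =>
    mul_nonneg (hp j) (by rw [← hnet.route_law 0 j 0 k u hu]; exact measureReal_nonneg)

variable [IsProbabilityMeasure P]

theorem IsNetwork.sum_mixedLocation_le (hnet : IsNetwork P lam q T S X) (hp : ∀ j, 0 ≤ p j)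
    (hp1 : ∑ j, p j = 1) {u : ℝ} (hu : 0 ≤ u) : ∑ k, mixedLocation p q k u ≤ 1 := by
  have hq : ∀ j, ∑ k, q j k u ≤ 1 := by
    intro j
    have h := sum_measureReal_le_measureReal_univ (μ := P) (s := Finset.univ)
      (t := fun k => {ω | X 0 j 0 u ω = some k})
      (fun k _ => hnet.measurableSet_location 0 j 0 k hu) (by
        intro k _ k' _ hkk
        rw [Function.onFun, Set.disjoint_left]
        intro ω h1 h2
        exact hkk (Option.some.inj (Eq.trans (Eq.symm h1) h2)))
    simpa [hnet.route_law 0 j 0 _ u hu] using h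
  simp only [mixedLocation]
  rw [Finset.sum_comm, ← hp1]
  refine Finset.sum_le_sum fun j _ => ?_
  rw [← Finset.mul_sum]
  exact mul_le_of_le_one_right (hp j) (hq j)

theorem IsNetwork.integrableOn_kernelOn (hnet : IsNetwork P lam q T S X) (hp : ∀ j, 0 ≤ p j)
    (hp1 : ∑ j, p j = 1) (ht : 0 ≤ t) (s : Finset (Fin J)) (N : ℕ) (α : unitInterval)
    (i : Fin J → ℕ) :
    IntegrableOn (fun τ => lam τ * kernelOn s N α (fun k => mixedLocation p q k (t - τ)) i)
      (Set.Icc 0 t) := by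
  -- The function `q` is controlled only at ages `≥ 0`, so it is replaced by `0` at negative ages;
  -- nothing changes on `[0, t]`.
  have hm : ∀ k, Measurable fun τ => ∑ j, p j * if 0 ≤ t - τ then q j k (t - τ) else 0 := fun k =>
    Finset.measurable_fun_sum _ fun j _ =>
      ((hnet.measurable_location j k).comp (measurable_const.sub measurable_id)).const_mul _
  have hK : Measurable fun τ =>
      kernelOn s N α (fun k => ∑ j, p j * if 0 ≤ t - τ then q j k (t - τ) else 0) i := by
    unfold kernelOn
    fun_prop
  have hbound : ∀ τ ∈ Set.Icc 0 t,
      ‖kernelOn s N α (fun k => mixedLocation p q k (t - τ)) i‖ ≤ N.factorial := by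
    intro τ hτ
    have hu : 0 ≤ t - τ := sub_nonneg.2 hτ.2
    have hr := fun k => hnet.mixedLocation_nonneg hp k hu
    have hαr : (α : ℝ) * ∑ k, mixedLocation p q k (t - τ) ≤ 1 :=
      mul_le_one₀ α.2.2 (Finset.sum_nonneg fun k _ => hr k) (hnet.sum_mixedLocation_le hp hp1 hu)
    rw [Real.norm_of_nonneg (kernelOn_nonneg s N i α.2.1 hr hαr)]
    exact kernelOn_le s N i α.2.1 hr hαr
  refine (hnet.arrivals.integrableOn ht).mul_bdd (c := N.factorial) ?_ ?_
  · refine hK.aestronglyMeasurable.congr ?_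
    filter_upwards [ae_restrict_mem measurableSet_Icc] with τ hτ
    have hu : 0 ≤ t - τ := sub_nonneg.2 hτ.2
    simp [mixedLocation, hu]
  · filter_upwards [ae_restrict_mem measurableSet_Icc] with τ hτ using hbound τ hτ

/-- Mixing over entry queues gives `w = 1 + ∑ r_k (z_k - 1)`, and `1 - α + α w` is the base of the
expansion in `sum_kernelOn_mul_prod_pow`. -/
theorem IsUnivariateBatch.vectorPgf_entryPgf (hnet : IsNetwork P lam q T S X)
    (hp1 : ∑ j, p j = 1) {N : ℕ} {α : unitInterval}
    (hbatch : IsUnivariateBatch P (binomial N α) p (S 0)) {z : Fin J → ℂ} (hz : ∀ k, ‖z k‖ ≤ 1)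
    {u : ℝ} (hu : 0 ≤ u) :
    vectorPgf P (S 0) (fun j => entryPgf q z j u) = ∑ i ∈ contributions J N,
      (kernelOn Finset.univ N α (fun k => mixedLocation p q k u) i : ℂ) * ∏ k, z k ^ i k := by
  rw [hbatch _ fun j => hnet.norm_entryPgf_le hz j u, pgf_binomial, sum_kernelOn_mul_prod_pow]
  congr 1
  have h : ∑ j, (p j : ℂ) * entryPgf q z j u =
      1 + ∑ k, (mixedLocation p q k u : ℂ) * (z k - 1) := by
    simp only [entryPgf, if_pos hu, mixedLocation, mul_add, mul_one, Finset.sum_add_distrib]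
    rw [← Complex.ofReal_sum, hp1, Complex.ofReal_one]
    congr 1
    push_cast
    simp_rw [Finset.mul_sum, Finset.sum_mul]
    rw [Finset.sum_comm]
    simp_rw [mul_assoc]
  rw [h]
  push_cast
  simp only [mul_sub, Finset.sum_sub_distrib, mul_one, mul_assoc, ← Finset.mul_sum]
  ring

/-- The rate at which batches contribute the vector `i` to the queues at time `t`. -/
noncomputable def contributionRate (lam : ℝ → ℝ) (p : Fin J → ℝ) (q : Fin J → Fin J → ℝ → ℝ)
    (N : ℕ) (α : ℝ) (t : ℝ) (i : Fin J → ℕ) : ℝ :=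
  ∫ τ in Set.Icc 0 t, lam τ * kernelOn Finset.univ N α (fun k => mixedLocation p q k (t - τ)) i

theorem IsNetwork.contributionRate_nonneg (hnet : IsNetwork P lam q T S X) (hp : ∀ j, 0 ≤ p j)
    (hp1 : ∑ j, p j = 1) (N : ℕ) (α : unitInterval) (i : Fin J → ℕ) :
    0 ≤ contributionRate lam p q N α t i := by
  refine setIntegral_nonneg measurableSet_Icc fun τ hτ => ?_
  have hu : 0 ≤ t - τ := sub_nonneg.2 hτ.2
  have hr := fun k => hnet.mixedLocation_nonneg hp k hu
  exact mul_nonneg (hnet.arrivals.rate_nonneg τ hτ.1) (kernelOn_nonneg _ _ _ α.2.1 hr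
    (mul_le_one₀ α.2.2 (Finset.sum_nonneg fun k _ => hr k) (hnet.sum_mixedLocation_le hp hp1 hu)))

/-- The numbers of customers in the queues have a multivariate compound Poisson law. -/
theorem IsNetwork.map_occupancy (hnet : IsNetwork P lam q T S X) (hp : ∀ j, 0 ≤ p j)
    (hp1 : ∑ j, p j = 1) (ht : 0 ≤ t) {N : ℕ} {α : unitInterval}
    (hbatch : IsUnivariateBatch P (binomial N α) p (S 0)) :
    P.map (occupancy T S X t) =
      compoundPoisson (fun i : contributions J N => (contributionRate lam p q N α t i).toNNReal)
        fun i => (i : Fin J → ℕ) := by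
  have hocc := hnet.aemeasurable_occupancy ht
  have : IsProbabilityMeasure (P.map (occupancy T S X t)) := Measure.isProbabilityMeasure_map hocc
  refine ext_of_pgf fun z hz => ?_
  have hz' : ∀ k, ‖z k‖ ≤ 1 := fun k => (hz k).le
  rw [integral_map hocc (by exact (Measurable.of_discrete).aestronglyMeasurable),
    hnet.integral_prod_pow_occupancy ht hz', integral_compoundPoisson]
  congr 1
  have hrate : ∀ i, ((contributionRate lam p q N α t i).toNNReal : ℂ) =
      ∫ τ in Set.Icc 0 t,
        ((lam τ * kernelOn Finset.univ N α (fun k => mixedLocation p q k (t - τ)) i : ℝ) : ℂ) := by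
    intro i
    rw [integral_complex_ofReal]
    exact congrArg _ (Real.coe_toNNReal _ (hnet.contributionRate_nonneg hp hp1 N α i))
  rw [Finset.sum_coe_sort (contributions J N) fun i =>
    ((contributionRate lam p q N α t i).toNNReal : ℂ) * (∏ k, z k ^ i k - 1)]
  simp_rw [hrate, ← integral_mul_const]
  rw [← integral_finsetSum]
  · refine setIntegral_congr_fun measurableSet_Icc fun τ hτ => ?_
    have hu : 0 ≤ t - τ := sub_nonneg.2 hτ.2
    -- Since the kernels sum to `1`, the generating function minus `1` is `∑ K_i (z^i - 1)`; the
    -- term `i = 0` is zero.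
    have h1 := sum_kernelOn N α fun k => mixedLocation p q k (t - τ)
    simp only [IsUnivariateBatch.vectorPgf_entryPgf hnet hp1 hbatch hz' hu, Complex.ofReal_mul,
      mul_assoc, ← Finset.mul_sum, mul_sub, mul_one, Finset.sum_sub_distrib]
    rw [← Complex.ofReal_sum, h1, Complex.ofReal_one, mul_one]
  · intro i _
    exact (hnet.integrableOn_kernelOn hp hp1 ht Finset.univ N α i).ofReal.mul_const _

open Classical in
theorem IsNetwork.occupancy_recurrence (hnet : IsNetwork P lam q T S X) (hp : ∀ j, 0 ≤ p j)
    (hp1 : ∑ j, p j = 1) (ht : 0 ≤ t) {N : ℕ} {α : unitInterval}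
    (hbatch : IsUnivariateBatch P (binomial N α) p (S 0)) (n : Fin J → ℕ) (v : Fin J) :
    (n v : ℝ) * P.real {ω | occupancy T S X t ω = n} =
      ∑ i ∈ contributions J N, if i ≤ n then
        (i v : ℝ) * (contributionRate lam p q N α t i * P.real {ω | occupancy T S X t ω = n - i})
      else 0 := by
  have hocc := hnet.aemeasurable_occupancy ht
  have : IsProbabilityMeasure (P.map (occupancy T S X t)) := Measure.isProbabilityMeasure_map hocc
  have hlaw := hnet.map_occupancy hp hp1 ht hbatch
  have h := congrArg ENNReal.toReal (compoundPoisson_recurrence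
    (fun i : contributions J N => (contributionRate lam p q N α t i).toNNReal)
    (fun i => (i : Fin J → ℕ)) n v)
  rw [← hlaw, ENNReal.toReal_sum (fun i _ => by finiteness)] at h
  have hmap : ∀ A : Set (Fin J → ℕ), ((P.map (occupancy T S X t)) A).toReal =
      P.real {ω | occupancy T S X t ω ∈ A} := fun A =>
    map_measureReal_apply_of_aemeasurable hocc .of_discrete
  simp only [ENNReal.toReal_mul, ENNReal.toReal_natCast, ENNReal.coe_toReal, hmap,
    Set.mem_singleton_iff, Real.coe_toNNReal _ (hnet.contributionRate_nonneg hp hp1 N α _)] at h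
  rw [h, Finset.sum_coe_sort (contributions J N) fun i => (i v : ℝ) *
    (contributionRate lam p q N α t i * P.real {ω | occupancy T S X t ω ∈ {m | m + i = n}})]
  refine Finset.sum_congr rfl fun i _ => ?_
  -- The set `{m | m + i = n}` is `{n - i}` when `i ≤ n` and empty otherwise; truncated subtraction
  -- alone would add spurious terms.
  split_ifs with hi
  · congr 3
    ext ω
    exact (eq_tsub_iff_add_eq_of_le hi).symm
  · have : {ω | occupancy T S X t ω ∈ {m | m + i = n}} = ∅ := by
      rw [Set.eq_empty_iff_forall_notMem]
      intro ω hω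
      exact hi (le_of_le_of_eq le_add_self hω)
    rw [this]
    simp

end Network

end BatchQueue

/-! ### The recurrence with its stated index set -/

/-- Queues are numbered from `0`, so `v : Fin J` with `1 ≤ v` stands for queues `2, ..., J`. -/
theorem corollary5p2 {Ω : Type*} [MeasurableSpace Ω] (P : Measure Ω) [IsProbabilityMeasure P]
    (J : ℕ) (lam : ℝ → ℝ) (q : Fin J → Fin J → ℝ → ℝ)
    (T : ℕ → Ω → ℝ≥0∞) (S : ℕ → Ω → Fin J → ℕ)
    (X : ℕ → Fin J → ℕ → ℝ → Ω → Option (Fin J))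
    (hnet : BatchQueue.IsNetwork P lam q T S X)
    (N : ℕ) (α : unitInterval)
    (p : Fin J → ℝ) (hp_nonneg : ∀ j, 0 ≤ p j) (hp_sum : ∑ j, p j = 1)
    (hbatch : BatchQueue.IsUnivariateBatch P (binomial N α) p (S 0))
    (t : ℝ) (ht : 0 ≤ t)
    (v : Fin J) (hv : 1 ≤ (v : ℕ))
    (n : Fin J → ℕ) (hnv : 1 ≤ n v) (hn : ∀ k, v < k → n k = 0) :
    (∀ i ∈ BatchQueue.recurrenceIndices n v, IntervalIntegrable
      (fun τ => lam τ * BatchQueue.binomialKernel N α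
        (fun k => BatchQueue.mixedLocation p q k (t - τ)) v i) volume 0 t) ∧
    P.real {ω | BatchQueue.occupancy T S X t ω = n} =
      ∑ i ∈ BatchQueue.recurrenceIndices n v,
        (i v : ℝ) / (n v : ℝ)
          * P.real {ω | BatchQueue.occupancy T S X t ω = n - i}
          * (if ∑ k ∈ Finset.Iic v, i k ≤ N then 1 else 0)
          * ∫ τ in (0 : ℝ)..t, lam τ * BatchQueue.binomialKernel N α
              (fun k => BatchQueue.mixedLocation p q k (t - τ)) v i := by
  refine ⟨fun i _ => (intervalIntegrable_iff_integrableOn_Icc_of_le ht).2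
    (hnet.integrableOn_kernelOn hp_nonneg hp_sum ht (Finset.Iic v) N α i), ?_⟩
  have hnv0 : (n v : ℝ) ≠ 0 := by
    have : n v ≠ 0 := by omega
    exact_mod_cast this
  have hrec := hnet.occupancy_recurrence hp_nonneg hp_sum ht hbatch n v
  have hmem : ∀ i, i ∈ BatchQueue.recurrenceIndices n v ↔ 1 ≤ i v ∧ i ≤ n := by
    intro i
    simp only [BatchQueue.recurrenceIndices, Fintype.mem_piFinset, Finset.mem_Icc]
    constructor
    · intro h
      exact ⟨by simpa using (h v).1, fun k => (h k).2⟩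
    · rintro ⟨h1, h2⟩ k
      refine ⟨?_, h2 k⟩
      split_ifs with hk
      · exact hk ▸ h1
      · exact Nat.zero_le _
  have hzero : ∀ i ∈ BatchQueue.recurrenceIndices n v, ∀ k ∉ Finset.Iic v, i k = 0 := by
    intro i hi k hk
    have h1 := ((hmem i).1 hi).2 k
    rw [hn k (by simpa using hk)] at h1
    exact Nat.le_zero.1 h1
  have hsum : ∀ i ∈ BatchQueue.recurrenceIndices n v, ∑ k ∈ Finset.Iic v, i k = ∑ k, i k :=
    fun i hi => Finset.sum_subset (Finset.subset_univ _) fun k _ hk => hzero i hi k hk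
  have hint : ∀ i ∈ BatchQueue.recurrenceIndices n v,
      ∫ τ in (0 : ℝ)..t, lam τ * BatchQueue.binomialKernel N α
        (fun k => BatchQueue.mixedLocation p q k (t - τ)) v i =
      BatchQueue.contributionRate lam p q N α t i := by
    intro i hi
    rw [intervalIntegral.integral_of_le ht, ← integral_Icc_eq_integral_Ioc]
    congr 1
    funext τ
    exact congrArg (lam τ * ·) (BatchQueue.kernelOn_eq_univ (hzero i hi) N α _)
  rw [← mul_right_inj' hnv0, hrec, Finset.mul_sum]
  -- Terms only in `contributions` have `i v = 0` or `¬ i ≤ n`, terms only in `recurrenceIndices`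
  -- have indicator `0`, and common terms agree.
  refine Finset.sum_congr_of_eq_on_inter ?_ ?_ ?_
  · intro i _ hi
    split_ifs with hin
    · have : i v = 0 := by
        by_contra h0
        exact hi ((hmem i).2 ⟨by omega, hin⟩)
      simp [this]
    · rfl
  · intro i hi hiN
    rw [BatchQueue.mem_contributions, ← hsum i hi] at hiN
    simp [hiN]
  · intro i hiN hi
    rw [BatchQueue.mem_contributions, ← hsum i hi] at hiN
    rw [if_pos hiN, if_pos ((hmem i).1 hi).2, hint i hi]
    field_simp
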